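/- **Theorem (Single-mode overlap for binned homodyne on finite-energy GKP Paulis).** Let $\epsilon>0$, $\sigma^2=\tfrac12\tanh\epsilon$, $\Sigma^2=\tfrac12\coth\epsilon$. On $L^2(\mathbb R)$ (one bosonic mode, $[\hat q,\hat p]=i$) let $|\mu_L^\epsilon\rangle$, $\mu\in\{0,1\}$, be the finite-energy square-lattice GKP codewords with wave functions $$\psi_\mu(x)=\frac{1}{\sqrt{\sqrt\pi\,\tanh\epsilon}}\sum_{s\in\mathbb Z}\exp\Big[-\frac{(x-(2s+\mu)\sqrt\pi\,\mathrm{sech}\,\epsilon)^2}{4\sigma^2}-\frac{((2s+\mu)\sqrt\pi)^2}{4\Sigma^2}\Big],$$ let $V_\epsilon=|0_L^\epsilon\rangle\langle0|+|1_L^\epsilon\rangle\langle1|$ and $\sigma_k^\epsilon=V_\epsilon\sigma_kV_\epsilon^\dagger$ for $k=0,1,2,3$, where $\sigma_0=\mathbb 1$ and $\sigma_1,\sigma_2,\sigma_3$ are the Pauli matrices $X,Y,Z$. For $m=(m_1,m_2)\in\mathbb Z^2$ put $c_m^\epsilon=\exp[-\tfrac\pi4\tanh(\epsilon)(m_1^2+m_2^2)]$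 and $\mu_m^\epsilon=\mathrm{sech}(\epsilon)\tfrac{\sqrt\pi}{2}m$. Let $\mathcal M_0,\mathcal M_1,\mathcal M_2,\mathcal M_3\subset\mathbb Z^2$ be the sets of $m$ congruent modulo $2$ to $(0,0),(1,0),(1,1),(0,1)$ respectively, and on them let $s_0(m)=1$, $s_1(m)=(-1)^{m_2/2}$, $s_2(m)=(-1)^{(m_1+m_2)/2}$, $s_3(m)=(-1)^{m_1/2}$. For $\theta\in\mathbb R$ and $o\in\{0,1\}$ let $M_o^{(\theta)}=\int_{R_o}|q_\theta\rangle\langle q_\theta|\,dq_\theta$ be the spectral projection of the rotated quadrature $\hat q_\theta=\hat q\cos\theta+\hat p\sin\theta$ onto $$R_o=\bigcup_{s\in\mathbb Z}\Big[(2s+o)\sqrt\pi-\tfrac{\sqrt\pi}{2},\,(2s+o)\sqrt\pi+\tfrac{\sqrt\pi}{2}\Big).$$ Then, for every $k\in\{0,1,2,3\}$: 1. The Wigner function $W_{\sigma_k^\epsilon}(q,p)=\frac1{2\pi}\int_{\mathbb R}e^{ipy}\langle q-\tfrac y2|\sigma_k^\epsilon|q+\tfrac y2\rangle\,dy$ is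 the Gaussian mixture $$W_{\sigma_k^\epsilon}(q,p)=(-1)^{\delta_{k,2}}\sum_{m\in\mathcal M_k}c_m^\epsilon\,s_k(m)\,G_{\mu_m^\epsilon,\sigma^2\mathbb 1}(q,p),$$ where $G_{\mu,\sigma^2\mathbb 1}$ is the density of the planar Gaussian with mean $\mu$ and covariance $\sigma^2\mathbb 1$; the series converges absolutely for all $q,p\in\mathbb R$. 2. For all $\theta\in\mathbb R$ and $o\in\{0,1\}$ the operator $M_o^{(\theta)}\sigma_k^\epsilon$ is of trace class and $$\mathrm{tr}\big(M_o^{(\theta)}\sigma_k^\epsilon\big)=(-1)^{\delta_{k,2}}\sum_{m\in\mathcal M_k}c_m^\epsilon\,s_k(m)\,\mathcal B_o(\mu_{\theta,m}),\qquad \mathcal B_o(\mu)=\frac12\sum_{\ell\in\mathbb Z}\big[\mathrm{erf}(a^+_{\ell,o}(\mu))-\mathrm{erf}(a^-_{\ell,o}(\mu))\big],$$ where $\mu_{\theta,m}=\mathrm{sech}(\epsilon)\tfrac{\sqrt\pi}{2}(m_1\cos\theta+m_2\sin\theta)$ and $a^\pm_{\ell,o}(\mu)=\frac{(2\ell+o\pm\frac12)\sqrt\pi-\mu}{\sqrt2\,\sigma}$.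 The series over $\ell$ (for every $\mu\in\mathbb R$), the series over $m$, and the double series over $(m,\ell)\in\mathcal M_k\times\mathbb Z$ all converge absolutely. -/

import Mathlib

open MeasureTheory Complex
open scoped ENNReal FourierTransform

noncomputable section

namespace GKP

/-! ### The single bosonic mode, traces, kernels and Wigner functions -/

/-- The Hilbert space `L²(ℝ)` of a single bosonic mode, in the position representation
(`ħ = 1`, `[q, p] = i`, `p = -i d/dx`). -/
abbrev Mode : Type := Lp (α := ℝ) ℂ 2 (volume : Measure ℝ)

/-- `T` has trace `z`: in every orthonormal basis the diagonal matrix elements of `T` are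
(absolutely) summable with sum `z`. For a bounded operator this says that `T` is of trace class
with `tr T = z`. -/
def HasTrace {H : Type} [NormedAddCommGroup H] [InnerProductSpace ℂ H]
    (T : H →L[ℂ] H) (z : ℂ) : Prop :=
  ∀ (ι : Type) (e : HilbertBasis ι ℂ H), HasSum (fun i => inner ℂ (e i) (T (e i))) z

/-- `K x y = ⟨x| A |y⟩`: the operator `A` on `L²(ℝ)` is the integral operator with the (unique)
continuous kernel `K`. -/
def HasPositionKernel (A : Mode →L[ℂ] Mode) (K : ℝ → ℝ → ℂ) : Prop :=
  Continuous (Function.uncurry K) ∧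
    ∀ f : Mode, ∀ᵐ x : ℝ, Integrable (fun y => K x y * f y) ∧ A f x = ∫ y, K x y * f y

/-- `W` is the Wigner function of `A`:
`W(q,p) = (2π)⁻¹ ∫ e^{ipy} ⟨q - y/2| A |q + y/2⟩ dy` for all `(q,p)`. -/
def HasWignerFunction (A : Mode →L[ℂ] Mode) (W : ℝ → ℝ → ℂ) : Prop :=
  ∃ K : ℝ → ℝ → ℂ, HasPositionKernel A K ∧ ∀ q p : ℝ,
    Integrable (fun y : ℝ => exp (I * p * y) * K (q - y / 2) (q + y / 2)) ∧
    W q p = 1 / (2 * Real.pi) * ∫ y : ℝ, exp (I * p * y) * K (q - y / 2) (q + y / 2)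

/-! ### Binned homodyne detection -/

/-- Multiplication by a bounded measurable function, as a bounded operator on `L²(ℝ)`. -/
def mulOp (m : ℝ → ℂ) (hm : Measurable m) (hb : ∀ x, ‖m x‖ ≤ 1) : Mode →L[ℂ] Mode :=
  (ContinuousLinearMap.mul ℂ ℂ).holderL volume ∞ 2 2
    ((memLp_top_of_bound hm.aestronglyMeasurable 1 (Filter.Eventually.of_forall hb)).toLp m)

/-- The chirp `x ↦ exp(i cot(θ) x² / 2)`. -/
def chirp (θ x : ℝ) : ℂ := exp (I * ((Real.cos θ / Real.sin θ * x ^ 2 / 2 : ℝ) : ℂ))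

theorem measurable_chirp (θ : ℝ) : Measurable (chirp θ) := by
  unfold chirp; fun_prop

theorem norm_chirp_le (θ x : ℝ) : ‖chirp θ x‖ ≤ 1 := by
  unfold chirp
  rw [mul_comm, Complex.norm_exp_ofReal_mul_I]

/-- A unitary that diagonalises the rotated quadrature `q_θ = q cos θ + p sin θ`.
For `sin θ ≠ 0` the generalised eigenfunctions of `q_θ` are
`⟨x|q_θ⟩ = (2π|sin θ|)^{-1/2} exp(i (q_θ x - cos θ x² / 2) / sin θ)`, so `⟨q_θ|f⟩` is, up to
a scaling of the argument, the Fourier transform `∫ e^{-2πi x ξ} chirp(x) f(x) dx` at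
`ξ = q_θ / (2π sin θ)`. For `sin θ = 0` one has `q_θ = q cos θ`, which is already diagonal. -/
def quadratureRep (θ : ℝ) : Mode →L[ℂ] Mode :=
  if Real.sin θ = 0 then ContinuousLinearMap.id ℂ Mode
  else ((Lp.fourierTransformₗᵢ ℝ ℂ).toContinuousLinearEquiv : Mode →L[ℂ] Mode) ∘L
    mulOp (chirp θ) (measurable_chirp θ) (norm_chirp_le θ)

/-- The value of `q_θ` at the point `ξ` of the representation `quadratureRep θ`. -/
def quadratureValue (θ ξ : ℝ) : ℝ :=
  if Real.sin θ = 0 then Real.cos θ * ξ else 2 * Real.pi * Real.sin θ * ξ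

/-- The periodic bins
`R_o = ⋃_s [(2s+o)√π - √π/2, (2s+o)√π + √π/2)`. -/
def bin (o : Fin 2) : Set ℝ :=
  ⋃ s : ℤ, Set.Ico ((2 * s + (o : ℕ)) * √Real.pi - √Real.pi / 2)
    ((2 * s + (o : ℕ)) * √Real.pi + √Real.pi / 2)

/-- The indicator function of `{ξ | q_θ(ξ) ∈ R_o}`. -/
def binIndicator (θ : ℝ) (o : Fin 2) : ℝ → ℂ :=
  (quadratureValue θ ⁻¹' bin o).indicator 1

theorem measurable_binIndicator (θ : ℝ) (o : Fin 2) : Measurable (binIndicator θ o) := by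
  have hq : Measurable (quadratureValue θ) := by
    unfold quadratureValue
    split_ifs <;> fun_prop
  exact measurable_one.indicator (hq (MeasurableSet.iUnion fun _ => measurableSet_Ico))

theorem norm_binIndicator_le (θ : ℝ) (o : Fin 2) (x : ℝ) : ‖binIndicator θ o x‖ ≤ 1 := by
  unfold binIndicator Set.indicator
  split_ifs <;> simp

/-- The binned homodyne POVM element `M_o^{(θ)} = ∫_{R_o} |q_θ⟩⟨q_θ| dq_θ`, i.e. the spectral
projection of the rotated quadrature `q_θ` onto `R_o`. -/
def homodyne (θ : ℝ) (o : Fin 2) : Mode →L[ℂ] Mode :=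
  (quadratureRep θ).adjoint ∘L
    mulOp (binIndicator θ o) (measurable_binIndicator θ o) (norm_binIndicator_le θ o) ∘L
    quadratureRep θ

/-! ### The finite-energy GKP code -/

/-- The `s`-th summand of the codeword wave function. -/
def gkpPeak (ε : ℝ) (μ : Fin 2) (s : ℤ) (x : ℝ) : ℝ :=
  Real.exp (-(x - (2 * s + (μ : ℕ)) * √Real.pi / Real.cosh ε) ^ 2 / (4 * (Real.tanh ε / 2))
    - ((2 * s + (μ : ℕ)) * √Real.pi) ^ 2 / (4 * (1 / Real.tanh ε / 2)))

/-- The position wave function of the finite-energy codeword `|μ_L^ε⟩`: with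
`σ² = tanh ε / 2` and `Σ² = coth ε / 2`,
`(√π tanh ε)^{-1/2} ∑_s exp(-(x - (2s+μ)√π sech ε)² / (4σ²) - ((2s+μ)√π)² / (4Σ²))`.
The (unnormalised) codewords `e^{-ε n} ∑_s |(2s+μ)√π⟩` are only fixed up to a common constant;
it is chosen such that the Wigner functions of the encoded Paulis carry no additional prefactor. -/
def gkpWave (ε : ℝ) (μ : Fin 2) (x : ℝ) : ℂ :=
  ((1 / √(√Real.pi * Real.tanh ε) * ∑' s : ℤ, gkpPeak ε μ s x : ℝ) : ℂ)

theorem gkpPeak_le {ε : ℝ} (hε : 0 < ε) (μ : Fin 2) (s : ℤ) (x : ℝ) :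
    gkpPeak ε μ s x ≤ Real.exp (-(Real.tanh ε / 8) * x ^ 2) *
      Real.exp (-(Real.tanh ε / 4)) ^ s.natAbs := by
  have ht : 0 < Real.tanh ε := by
    rw [Real.tanh_eq_sinh_div_cosh]
    exact div_pos (Real.sinh_pos_iff.2 hε) (Real.cosh_pos ε)
  have ht1 : Real.tanh ε < 1 := Real.tanh_lt_one ε
  have hc : 1 ≤ Real.cosh ε := Real.one_le_cosh ε
  have hi1 : 1 / Real.cosh ε ≤ 1 := by rw [div_le_one (by linarith)]; exact hc
  have hi0 : 0 < 1 / Real.cosh ε := by positivity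
  have hs : (s.natAbs : ℝ) ≤ (2 * s + (μ : ℕ)) ^ 2 := by
    have h1 : |s| ≤ |2 * s + ((μ : ℕ) : ℤ)| := by
      have := μ.isLt
      rcases abs_cases s with h | h <;> rcases abs_cases (2 * s + ((μ : ℕ) : ℤ)) with h' | h' <;>
        omega
    have h2 : |2 * s + ((μ : ℕ) : ℤ)| ≤ |2 * s + ((μ : ℕ) : ℤ)| ^ 2 :=
      Int.le_self_sq _
    rw [sq_abs] at h2
    rw [Nat.cast_natAbs]
    exact_mod_cast h1.trans h2
  rw [gkpPeak, ← Real.exp_nat_mul, ← Real.exp_add, Real.exp_le_exp]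
  set t := Real.tanh ε
  set n : ℝ := 2 * s + (μ : ℕ)
  have hX : (s.natAbs : ℝ) ≤ (n * √Real.pi) ^ 2 := by
    rw [mul_pow, Real.sq_sqrt Real.pi_pos.le]
    nlinarith [Real.pi_gt_three, sq_nonneg n]
  set X := n * √Real.pi
  have e1 : -(x - X / Real.cosh ε) ^ 2 / (4 * (t / 2)) ≤ -(t / 4) * (x - X / Real.cosh ε) ^ 2 := by
    rw [div_le_iff₀ (by positivity)]
    have : t * t ≤ 1 := by nlinarith
    nlinarith [mul_nonneg (sub_nonneg.2 this) (sq_nonneg (x - X / Real.cosh ε)),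
      sq_nonneg (x - X / Real.cosh ε)]
  have e2 : X ^ 2 / (4 * (1 / t / 2)) = t / 2 * X ^ 2 := by
    field_simp
    ring
  have e3 : (X / Real.cosh ε) ^ 2 ≤ X ^ 2 := by
    rw [div_pow]
    exact div_le_self (sq_nonneg X) (by nlinarith)
  set Y := X / Real.cosh ε
  have e4 : x ^ 2 / 2 - X ^ 2 ≤ (x - Y) ^ 2 := by nlinarith [sq_nonneg (x - 2 * Y)]
  rw [e2]
  nlinarith [mul_le_mul_of_nonneg_left e4 ht.le, mul_le_mul_of_nonneg_left hX ht.le]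

theorem summable_gkpPeak_bound {ε : ℝ} (hε : 0 < ε) :
    Summable fun s : ℤ => Real.exp (-(Real.tanh ε / 4)) ^ s.natAbs := by
  have ht : 0 < Real.tanh ε := by
    rw [Real.tanh_eq_sinh_div_cosh]
    exact div_pos (Real.sinh_pos_iff.2 hε) (Real.cosh_pos ε)
  have h : Summable fun n : ℕ => Real.exp (-(Real.tanh ε / 4)) ^ n :=
    summable_geometric_of_lt_one (Real.exp_pos _).le (Real.exp_lt_one_iff.2 (by linarith))
  exact Summable.of_nat_of_neg (by simpa using h) (by simpa using h)

theorem memLp_gkpWave {ε : ℝ} (hε : 0 < ε) (μ : Fin 2) : MemLp (gkpWave ε μ) 2 volume := by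
  have ht : 0 < Real.tanh ε := by
    rw [Real.tanh_eq_sinh_div_cosh]
    exact div_pos (Real.sinh_pos_iff.2 hε) (Real.cosh_pos ε)
  set r := Real.exp (-(Real.tanh ε / 4))
  have hsum := summable_gkpPeak_bound hε
  have hpos : ∀ s x, 0 ≤ gkpPeak ε μ s x := fun s x => (Real.exp_pos _).le
  have hbd : ∀ s x, gkpPeak ε μ s x ≤ r ^ s.natAbs := fun s x =>
    (gkpPeak_le hε μ s x).trans (mul_le_of_le_one_left (by positivity)
      (Real.exp_le_one_iff.2 (by nlinarith [sq_nonneg x])))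
  have hcont : Continuous fun x => ∑' s : ℤ, gkpPeak ε μ s x := by
    refine continuous_tsum (fun s => ?_) hsum (fun s x => ?_)
    · unfold gkpPeak; fun_prop
    · rw [Real.norm_of_nonneg (hpos s x)]; exact hbd s x
  have hg : MemLp (fun x : ℝ => Real.exp (-(Real.tanh ε / 8) * x ^ 2)) 2 volume := by
    rw [memLp_two_iff_integrable_sq (by fun_prop)]
    have := integrable_exp_neg_mul_sq (b := Real.tanh ε / 4) (by positivity)
    refine this.congr (Filter.Eventually.of_forall fun x => ?_)
    simp only [← Real.exp_nat_mul]
    congr 1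
    push_cast
    ring
  have hg' := hg.const_mul (1 / √(√Real.pi * Real.tanh ε) * ∑' s : ℤ, r ^ s.natAbs)
  refine hg'.of_le ?_ (Filter.Eventually.of_forall fun x => ?_)
  · unfold gkpWave
    exact (Complex.continuous_ofReal.comp (hcont.const_mul _)).aestronglyMeasurable
  · have h1 : ∑' s : ℤ, gkpPeak ε μ s x ≤
        Real.exp (-(Real.tanh ε / 8) * x ^ 2) * ∑' s : ℤ, r ^ s.natAbs := by
      rw [← tsum_mul_left]
      exact (hsum.of_nonneg_of_le (hpos · x) (hbd · x)).tsum_le_tsum (gkpPeak_le hε μ · x)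
        (hsum.mul_left _)
    have h0 : 0 ≤ ∑' s : ℤ, gkpPeak ε μ s x := tsum_nonneg (hpos · x)
    have h2 : 0 ≤ 1 / √(√Real.pi * Real.tanh ε) := by positivity
    rw [gkpWave, Complex.norm_real, Real.norm_of_nonneg (mul_nonneg h2 h0)]
    refine le_trans ?_ (le_abs_self _)
    calc _ ≤ _ := mul_le_mul_of_nonneg_left h1 h2
      _ = _ := by ring

/-- The finite-energy codeword `|μ_L^ε⟩`. -/
def gkpKet {ε : ℝ} (hε : 0 < ε) (μ : Fin 2) : Mode := (memLp_gkpWave hε μ).toLp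

/-- The encoding map `V_ε = |0_L^ε⟩⟨0| + |1_L^ε⟩⟨1|`. -/
def encoding {ε : ℝ} (hε : 0 < ε) : EuclideanSpace ℂ (Fin 2) →L[ℂ] Mode :=
  ∑ μ : Fin 2, (EuclideanSpace.proj μ : EuclideanSpace ℂ (Fin 2) →L[ℂ] ℂ).smulRight (gkpKet hε μ)

/-- The Pauli matrices `σ_0 = 1`, `σ_1 = X`, `σ_2 = Y`, `σ_3 = Z`. -/
def pauli (k : Fin 4) : Matrix (Fin 2) (Fin 2) ℂ :=
  match k with
  | 0 => 1
  | 1 => !![0, 1; 1, 0]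
  | 2 => !![0, -I; I, 0]
  | 3 => !![1, 0; 0, -1]

/-- The finite-energy GKP Pauli operator `σ_k^ε = V_ε σ_k V_ε†`. -/
def gkpPauli {ε : ℝ} (hε : 0 < ε) (k : Fin 4) : Mode →L[ℂ] Mode :=
  encoding hε ∘L Matrix.toEuclideanCLM (𝕜 := ℂ) (pauli k) ∘L (encoding hε).adjoint

/-! ### Lattice data -/

/-- The cosets `M_k` of `(2ℤ)²` in `ℤ²`. -/
def coset (k : Fin 4) : Set (ℤ × ℤ) :=
  match k with
  | 0 => {m | Even m.1 ∧ Even m.2}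
  | 1 => {m | Odd m.1 ∧ Even m.2}
  | 2 => {m | Odd m.1 ∧ Odd m.2}
  | 3 => {m | Even m.1 ∧ Odd m.2}

/-- The sign patterns `s_k`; all integer divisions below are exact for `m ∈ M_k`. -/
def sgn (k : Fin 4) (m : ℤ × ℤ) : ℝ :=
  match k with
  | 0 => 1
  | 1 => (-1) ^ (m.2 / 2)
  | 2 => (-1) ^ ((m.1 + m.2) / 2)
  | 3 => (-1) ^ (m.1 / 2)

/-- `(-1)^{δ_{k,2}}`. -/
def ySign (k : Fin 4) : ℝ := if k = 2 then -1 else 1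

/-- The envelope weights `c_m^ε`. -/
def weight (ε : ℝ) (m : ℤ × ℤ) : ℝ :=
  Real.exp (-(Real.pi / 4) * Real.tanh ε * ((m.1 : ℝ) ^ 2 + (m.2 : ℝ) ^ 2))

/-- The peak width `σ`, `σ² = tanh ε / 2`. -/
def peakWidth (ε : ℝ) : ℝ := √(Real.tanh ε / 2)

/-- The density at `(q,p)` of the planar Gaussian with mean `sech(ε) (√π/2) m` and covariance
matrix `σ² 1`. -/
def latticeGaussian (ε : ℝ) (m : ℤ × ℤ) (q p : ℝ) : ℝ :=
  1 / (2 * Real.pi * peakWidth ε ^ 2) *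
    Real.exp (-((q - 1 / Real.cosh ε * (√Real.pi / 2) * m.1) ^ 2
        + (p - 1 / Real.cosh ε * (√Real.pi / 2) * m.2) ^ 2) / (2 * peakWidth ε ^ 2))

/-- The projection `μ_{θ,m}` of the lattice point with label `m` onto the measured quadrature. -/
def projMean (ε θ : ℝ) (m : ℤ × ℤ) : ℝ :=
  1 / Real.cosh ε * (√Real.pi / 2) * (m.1 * Real.cos θ + m.2 * Real.sin θ)

/-- The error function. -/
def erf (x : ℝ) : ℝ := 2 / √Real.pi * ∫ t in (0 : ℝ)..x, Real.exp (-t ^ 2)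

/-- The contribution `½ [erf(a⁺_{ℓ,o}(μ)) - erf(a⁻_{ℓ,o}(μ))]` of the `ℓ`-th interval of `R_o`,
where `a^±_{ℓ,o}(μ) = ((2ℓ + o ± ½)√π - μ) / (√2 σ)`. -/
def binTerm (ε : ℝ) (o : Fin 2) (μ : ℝ) (l : ℤ) : ℝ :=
  1 / 2 * (erf (((2 * l + (o : ℕ) + 1 / 2) * √Real.pi - μ) / (√2 * peakWidth ε))
    - erf (((2 * l + (o : ℕ) - 1 / 2) * √Real.pi - μ) / (√2 * peakWidth ε)))

/-- The binning function `B_o(μ)`. -/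
def binning (ε : ℝ) (o : Fin 2) (μ : ℝ) : ℝ := ∑' l : ℤ, binTerm ε o μ l

end GKP

end

noncomputable section

namespace GKP


/-! ### Rank-one decompositions -/

/-! The operator `gkpPauli hε k` is a finite combination of the rank-one operators |μ⟩⟨ν|, and each
codeword is a sum of Gaussian peaks labelled by the integers n ≡ μ mod 2. Both the Wigner function
and the density of a rotated quadrature are therefore double sums over pairs of peaks (n, n') with
Pauli coefficients. In both cases the contribution of a pair has the form A(n+n') exp(-πT d² + 2πi
z(n+n') d), with d = (n'-n)/2.

The Pauli matrix keeps only pairs with n + n' of the parity of m₁ on `coset k`, so n + n' becomes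
the label m₁. For fixed m₁, Poisson summation over d produces a Gaussian in m₂/2. The half-integer
offset of d and the sign (-1)^n turn into a sign and a half-integer shift of the dual lattice, which
together give `coset k` and the pattern `sgn k`. This is `tsum_pauli_resummation`. It remains to
match exponents with weight times Gaussian, by completing a square in m₂ and using sech² = 1 -
tanh²: `weight_mul_latticeGaussian` for the Wigner function, `exists_density_parameters` for the
quadratures.

For the overlaps, Parseval reduces the trace to matrix elements ⟨ν|M|μ⟩, which are integrals over
the bin in the representation diagonalising q_θ. The density there is computed directly from the
rotated peaks, not as a marginal of the Wigner function. Integrating the mixture termwise over the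
bin gives the error functions. Every interchange is justified by geometric or Gaussian majorants. -/

theorem encoding_apply {ε : ℝ} (hε : 0 < ε) (v : EuclideanSpace ℂ (Fin 2)) :
    encoding hε v = ∑ μ, v μ • gkpKet hε μ := by
  simp [encoding]

theorem adjoint_encoding_apply {ε : ℝ} (hε : 0 < ε) (f : Mode) (ν : Fin 2) :
    (encoding hε).adjoint f ν = inner ℂ (gkpKet hε ν) f := by
  have h : inner ℂ (EuclideanSpace.single ν (1 : ℂ)) ((encoding hε).adjoint f) =
      inner ℂ (encoding hε (EuclideanSpace.single ν (1 : ℂ))) f :=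
    ContinuousLinearMap.adjoint_inner_right _ _ _
  rw [EuclideanSpace.inner_single_left, encoding_apply, map_one, one_mul] at h
  rw [h]
  fin_cases ν <;> simp

theorem gkpPauli_apply {ε : ℝ} (hε : 0 < ε) (k : Fin 4) (f : Mode) :
    gkpPauli hε k f =
      ∑ μ, ∑ ν, (pauli k μ ν * inner ℂ (gkpKet hε ν) f) • gkpKet hε μ := by
  rw [gkpPauli, ContinuousLinearMap.comp_apply, encoding_apply]
  refine Finset.sum_congr rfl fun μ _ => ?_
  rw [← Finset.sum_smul]
  congr 1
  simp [Matrix.mulVec, dotProduct, adjoint_encoding_apply]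

/-- By Parseval, ∑ᵢ ⟨ν|eᵢ⟩⟨eᵢ|Tμ⟩ = ⟨ν|Tμ⟩ in every orthonormal basis, so finite rank settles trace
class and value together. -/
theorem hasTrace_comp_gkpPauli {ε : ℝ} (hε : 0 < ε) (k : Fin 4) (T : Mode →L[ℂ] Mode) :
    HasTrace (T ∘L gkpPauli hε k)
      (∑ μ, ∑ ν, pauli k μ ν * inner ℂ (gkpKet hε ν) (T (gkpKet hε μ))) := by
  intro ι e
  have h (i : ι) : inner ℂ (e i) ((T ∘L gkpPauli hε k) (e i)) =
      ∑ μ, ∑ ν, pauli k μ ν *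
        (inner ℂ (gkpKet hε ν) (e i) * inner ℂ (e i) (T (gkpKet hε μ))) := by
    simp only [ContinuousLinearMap.comp_apply, gkpPauli_apply, map_sum, map_smul, inner_sum,
      inner_smul_right, mul_assoc]
  simp only [h]
  exact hasSum_sum fun μ _ => hasSum_sum fun ν _ =>
    (e.hasSum_inner_mul_inner _ _).mul_left _

theorem mulOp_coeFn (m : ℝ → ℂ) (hm : Measurable m) (hb : ∀ x, ‖m x‖ ≤ 1) (f : Mode) :
    mulOp m hm hb f =ᵐ[volume] fun x => m x * f x := by
  have h := ContinuousLinearMap.coeFn_holder (μ := (volume : Measure ℝ)) (r := 2)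
    (ContinuousLinearMap.mul ℂ ℂ)
    ((memLp_top_of_bound hm.aestronglyMeasurable 1 (Filter.Eventually.of_forall hb)).toLp m) f
  filter_upwards [h, MemLp.coeFn_toLp (memLp_top_of_bound hm.aestronglyMeasurable 1
    (Filter.Eventually.of_forall hb))] with x h1 h2
  rw [← h2]
  exact h1

/-! ### The Fourier transform on `L¹ ∩ L²` -/

/-- Both sides have the same pairing with every test function φ, namely ∫ 𝓕φ · f: the L² transform
by its compatibility with tempered distributions, the integral by Fubini. -/
theorem fourierTransformₗᵢ_ae_eq (f : Mode) (hf : Integrable f) :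
    Lp.fourierTransformₗᵢ ℝ ℂ f =ᵐ[volume] 𝓕 (f : ℝ → ℂ) := by
  have hcont : Continuous (𝓕 (f : ℝ → ℂ)) :=
    VectorFourier.fourierIntegral_continuous Real.continuous_fourierChar
      (by exact continuous_inner) hf
  refine ae_eq_of_integral_contDiff_smul_eq
    ((Lp.memLp (Lp.fourierTransformₗᵢ ℝ ℂ f)).locallyIntegrable (by norm_num))
    hcont.locallyIntegrable fun g hg hgs => ?_
  have hgs' : HasCompactSupport fun x => (g x : ℂ) := hgs.comp_left (g := Complex.ofReal) rfl
  let φ : SchwartzMap ℝ ℂ := hgs'.toSchwartzMap (ofRealCLM.contDiff.comp hg)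
  have h := congrArg (fun T => T φ) (Lp.fourier_toTemperedDistribution_eq f)
  simp only [TemperedDistribution.fourier_apply, Lp.toTemperedDistribution_apply] at h
  have e : ∀ x, (φ x : ℂ) = g x := fun x => rfl
  have h2 := VectorFourier.integral_fourierIntegral_smul_eq_flip (L := innerₗ ℝ)
    (μ := volume) (ν := volume) (f := φ) (g := f) Real.continuous_fourierChar
    (by exact continuous_inner) φ.integrable hf
  have h3 : ∫ x, (𝓕 φ) x • f x = ∫ x, φ x • 𝓕 (f : ℝ → ℂ) x := by
    rw [flip_innerₗ] at h2
    exact h2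
  rw [h3] at h
  simp only [e] at h
  simp only [Complex.real_smul]
  exact h.symm


/-! ### Poisson summation over a coset of `(2ℤ)²` -/

/-- Poisson summation for a Gaussian over ℤ + a/2. The translation by a/2 appears on the dual side
as the character (-1)^(al). -/
theorem tsum_shifted_gaussian {T : ℝ} (hT : 0 < T) (a : ℕ) (w : ℝ) :
    ∑' j : ℤ, cexp (-Real.pi * T * ((j : ℂ) + a / 2) ^ 2
        + 2 * Real.pi * I * w * ((j : ℂ) + a / 2)) =
      1 / (√T : ℂ) * ∑' l : ℤ, (-1) ^ (a * l) * cexp (-(Real.pi / T) * ((l : ℂ) - w) ^ 2) := by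
  have hT' : (T : ℂ) ≠ 0 := ofReal_ne_zero.2 hT.ne'
  have h := Complex.tsum_exp_neg_quadratic (a := (T : ℂ)) (by simpa using hT)
    -- Expanding (j + a/2)² moves the shift into the linear coefficient, which is allowed to be
    -- complex.
    (-(T * a / 2) + I * w)
  have hs : (T : ℂ) ^ (1 / 2 : ℂ) = (√T : ℂ) := by
    rw [Real.sqrt_eq_rpow, Complex.ofReal_cpow hT.le]
    norm_num
  rw [hs] at h
  have e1 (j : ℤ) : cexp (-Real.pi * T * ((j : ℂ) + a / 2) ^ 2
        + 2 * Real.pi * I * w * ((j : ℂ) + a / 2)) =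
      cexp (-Real.pi * T * a ^ 2 / 4 + Real.pi * I * w * a) *
        cexp (-Real.pi * T * (j : ℂ) ^ 2 + 2 * Real.pi * (-(T * a / 2) + I * w) * j) := by
    rw [← Complex.exp_add]
    congr 1
    ring
  have e2 (l : ℤ) : cexp (-Real.pi * T * a ^ 2 / 4 + Real.pi * I * w * a) *
      cexp (-Real.pi / T * ((l : ℂ) + I * (-(T * a / 2) + I * w)) ^ 2) =
      (-1) ^ (a * l) * cexp (-(Real.pi / T) * ((l : ℂ) - w) ^ 2) := by
    rw [← Complex.exp_pi_mul_I, ← Complex.exp_int_mul, ← Complex.exp_add, ← Complex.exp_add]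
    congr 1
    push_cast
    field_simp
    ring_nf
    simp only [I_sq, show I ^ 3 = -I by rw [pow_succ, I_sq]; ring,
      show I ^ 4 = 1 by rw [show 4 = 2 * 2 from rfl, pow_mul, I_sq]; ring]
    ring
  simp_rw [e1]
  rw [tsum_mul_left, h, ← mul_assoc, mul_comm _ (1 / (√T : ℂ)), mul_assoc, ← tsum_mul_left]
  simp_rw [e2]

/-- The parity by which `σ_k` shifts the codeword label. -/
def shiftBit (k : Fin 4) : ℕ := ![0, 1, 1, 0] k

/-- The parity of the phase that `σ_k` applies to the codeword label. -/
def phaseBit (k : Fin 4) : ℕ := ![0, 0, 1, 1] k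

/-- With a, b the shift and phase bits, σ_k = (-i)^(ab) Z^b X^a. This single formula lets the
resummation treat all k at once. -/
theorem pauli_apply (k : Fin 4) (μ ν : Fin 2) :
    pauli k μ ν = if Even ((μ : ℕ) + (ν : ℕ) + shiftBit k) then
      (-I) ^ (shiftBit k * phaseBit k) * (-1) ^ (phaseBit k * (μ : ℕ)) else 0 := by
  fin_cases k <;> fin_cases μ <;> fin_cases ν <;>
    simp [pauli, shiftBit, phaseBit, Nat.even_iff]

theorem mem_coset_iff (k : Fin 4) (m : ℤ × ℤ) :
    m ∈ coset k ↔ Even (m.1 + shiftBit k) ∧ Even (m.2 + phaseBit k) := by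
  fin_cases k <;> simp [coset, shiftBit, phaseBit]

/-- For k = 2 the exponent (m₁ + m₂)/2 is u + l + 1, and the prefactor `ySign` is exactly what
cancels the extra sign. -/
theorem ySign_mul_sgn (k : Fin 4) (u l : ℤ) :
    ySign k * sgn k (2 * u + shiftBit k, 2 * l + phaseBit k) =
      (-1) ^ (phaseBit k * u + shiftBit k * l) := by
  have h : (2 * u + 1 + (2 * l + 1)) / 2 = u + l + 1 := by omega
  fin_cases k <;> simp [ySign, sgn, shiftBit, phaseBit, h, zpow_add₀]

theorem abs_sgn (k : Fin 4) (m : ℤ × ℤ) : |sgn k m| = 1 := by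
  fin_cases k <;> simp [sgn, abs_zpow]

/-- `ℤ²` parametrises `M_k`. -/
def cosetEquiv (k : Fin 4) : ℤ × ℤ ≃ coset k where
  toFun x := ⟨(2 * x.1 + shiftBit k, 2 * x.2 + phaseBit k), by
    rw [mem_coset_iff]
    exact ⟨⟨x.1 + shiftBit k, by ring⟩, ⟨x.2 + phaseBit k, by ring⟩⟩⟩
  invFun m := ((m.1.1 - shiftBit k) / 2, (m.1.2 - phaseBit k) / 2)
  left_inv x := by simp
  right_inv m := by
    obtain ⟨⟨a, ha⟩, ⟨b, hb⟩⟩ := (mem_coset_iff k m).1 m.2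
    ext <;> simp only <;> omega

/-- Integers in the form `2 s + μ` with `μ ∈ {0, 1}`. -/
def bitEquiv : ℤ ≃ Fin 2 × ℤ := (Int.divModEquiv 2).trans (Equiv.prodComm ℤ (Fin 2))

theorem bitEquiv_symm_apply (x : Fin 2 × ℤ) :
    bitEquiv.symm x = 2 * x.2 + ((x.1 : ℕ) : ℤ) := by
  simp [bitEquiv, mul_comm]

theorem two_mul_bitEquiv (n : ℤ) :
    2 * (bitEquiv n).2 + (((bitEquiv n).1 : ℕ) : ℤ) = n := by
  rw [← bitEquiv_symm_apply, Equiv.symm_apply_apply]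

theorem pauli_bitEquiv (k : Fin 4) (n n' : ℤ) :
    pauli k (bitEquiv n).1 (bitEquiv n').1 = if Even (n + n' + shiftBit k) then
      (-I) ^ (shiftBit k * phaseBit k) * (-1) ^ (phaseBit k * n) else 0 := by
  obtain ⟨μ, s, rfl⟩ : ∃ (μ : Fin 2) (s : ℤ), n = bitEquiv.symm (μ, s) :=
    ⟨(bitEquiv n).1, (bitEquiv n).2, by simp⟩
  obtain ⟨ν, r, rfl⟩ : ∃ (μ : Fin 2) (s : ℤ), n' = bitEquiv.symm (μ, s) :=
    ⟨(bitEquiv n').1, (bitEquiv n').2, by simp⟩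
  rw [Equiv.apply_symm_apply, Equiv.apply_symm_apply, pauli_apply, bitEquiv_symm_apply,
    bitEquiv_symm_apply]
  have h1 : Even ((μ : ℕ) + (ν : ℕ) + shiftBit k) ↔
      Even (2 * s + ((μ : ℕ) : ℤ) + (2 * r + ((ν : ℕ) : ℤ)) + shiftBit k) := by
    rw [Nat.even_iff, Int.even_iff]
    omega
  have h2 : (-1 : ℂ) ^ (phaseBit k * (μ : ℕ)) =
      (-1) ^ (phaseBit k * (2 * s + ((μ : ℕ) : ℤ))) := by
    rw [mul_add, zpow_add₀ (by norm_num), mul_left_comm, zpow_mul]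
    norm_num
    exact_mod_cast rfl
  simp only [h1, h2]

/-- With a, b the two bits, (-i)^(ab) (-1)^(bj) = exp(-πi b (j + a/2)). The Pauli phase is thus
linear in the summation variable and only replaces z by z - b/2, which makes the dual label m₂ = 2l
+ b. -/
theorem tsum_pauli_fiber (k : Fin 4) {T : ℝ} (hT : 0 < T) (z : ℝ) (u : ℤ) :
    ∑' j : ℤ, (-I) ^ (shiftBit k * phaseBit k) * (-1) ^ (phaseBit k * (u - j)) *
        cexp (-Real.pi * T * ((j : ℂ) + shiftBit k / 2) ^ 2
          + 2 * Real.pi * I * z * ((j : ℂ) + shiftBit k / 2)) =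
      ∑' l : ℤ, (-1) ^ (phaseBit k * u + shiftBit k * l) *
        (1 / (√T : ℂ) * cexp (-(Real.pi / T) * ((l : ℂ) + phaseBit k / 2 - z) ^ 2)) := by
  have h := tsum_shifted_gaussian hT (shiftBit k) (z - phaseBit k / 2)
  have e1 (j : ℤ) : (-I) ^ (shiftBit k * phaseBit k) * (-1) ^ (phaseBit k * (u - j)) *
        cexp (-Real.pi * T * ((j : ℂ) + shiftBit k / 2) ^ 2
          + 2 * Real.pi * I * z * ((j : ℂ) + shiftBit k / 2)) =
      (-1) ^ (phaseBit k * u) * cexp (-Real.pi * T * ((j : ℂ) + shiftBit k / 2) ^ 2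
          + 2 * Real.pi * I * (z - phaseBit k / 2 : ℝ) * ((j : ℂ) + shiftBit k / 2)) := by
    have hI : (-I) ^ (shiftBit k * phaseBit k) =
        cexp (-(Real.pi / 2 * I) * (shiftBit k * phaseBit k)) := by
      have : -I = cexp (-(Real.pi / 2 * I)) := by
        rw [Complex.exp_neg, Complex.exp_pi_div_two_mul_I, inv_I]
      rw [this, ← Complex.exp_nat_mul]
      congr 1
      push_cast
      ring
    have hm : (-1 : ℂ) ^ (phaseBit k * (u - j)) =
        (-1) ^ (phaseBit k * u) * cexp (-(Real.pi * I) * (phaseBit k * j)) := by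
      rw [mul_sub, zpow_sub₀ (by norm_num), div_eq_mul_inv, ← zpow_neg]
      congr 1
      rw [← Complex.exp_pi_mul_I, ← Complex.exp_int_mul]
      congr 1
      push_cast
      ring
    rw [hI, hm, mul_left_comm, mul_assoc, ← Complex.exp_add, mul_assoc, ← Complex.exp_add]
    congr 2
    push_cast
    ring
  simp_rw [e1]
  rw [tsum_mul_left, h, ← mul_assoc, ← tsum_mul_left]
  refine tsum_congr fun l => ?_
  rw [zpow_add₀ (by norm_num)]
  push_cast
  rw [show (l : ℂ) - (z - phaseBit k / 2) = l + phaseBit k / 2 - z by ring]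
  ring

/-- The common core of both claims: `F` is the contribution of a pair of peaks and `G` the target
weight times Gaussian. Summability is required on both sides because Poisson summation acts only on
the inner sum at fixed n + n'. -/
theorem tsum_pauli_resummation (k : Fin 4) {T : ℝ} (hT : 0 < T) {F : ℤ → ℤ → ℂ} {A : ℤ → ℂ}
    {z : ℤ → ℝ} {G : ℤ × ℤ → ℝ}
    (hF : Summable fun x : (Fin 2 × ℤ) × (Fin 2 × ℤ) =>
      pauli k x.1.1 x.2.1 * F (2 * x.1.2 + (x.1.1 : ℕ)) (2 * x.2.2 + (x.2.1 : ℕ)))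
    (hFA : ∀ n n', F n n' = A (n + n') * cexp (-Real.pi * T * (((n' : ℂ) - n) / 2) ^ 2
      + 2 * Real.pi * I * z (n + n') * (((n' : ℂ) - n) / 2)))
    (hG : ∀ m₁ m₂ : ℤ, (G (m₁, m₂) : ℂ) = A m₁ *
      (1 / (√T : ℂ) * cexp (-(Real.pi / T) * ((m₂ : ℂ) / 2 - z m₁) ^ 2)))
    (hs : Summable fun m : coset k => sgn k m * G m) :
    ∑' x : (Fin 2 × ℤ) × (Fin 2 × ℤ),
        pauli k x.1.1 x.2.1 * F (2 * x.1.2 + (x.1.1 : ℕ)) (2 * x.2.2 + (x.2.1 : ℕ)) =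
      ((ySign k * ∑' m : coset k, sgn k m * G m : ℝ) : ℂ) := by
  let E := Equiv.prodCongr bitEquiv bitEquiv
  have hE (x : ℤ × ℤ) : pauli k (E x).1.1 (E x).2.1 *
      F (2 * (E x).1.2 + ((E x).1.1 : ℕ)) (2 * (E x).2.2 + ((E x).2.1 : ℕ)) =
      pauli k (bitEquiv x.1).1 (bitEquiv x.2).1 * F x.1 x.2 := by
    simp only [E, Equiv.prodCongr_apply, Prod.map_fst, Prod.map_snd, two_mul_bitEquiv]
  rw [← E.tsum_eq]
  rw [← E.summable_iff] at hF
  simp only [Function.comp_def, hE] at hF ⊢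
  -- With (n, n') the image of (u, j), n + n' = 2u + a is the future m₁ and (n' - n)/2 = j + a/2.
  -- The range consists of the pairs on which the Pauli entry can be nonzero.
  let φ : ℤ × ℤ → ℤ × ℤ := fun x => (x.1 - x.2, x.1 + x.2 + (shiftBit k : ℤ))
  have hφ : Function.Injective φ := fun x y h => by
    simp only [φ, Prod.mk.injEq] at h
    ext <;> omega
  have hsupp : (Function.support fun x : ℤ × ℤ =>
      pauli k (bitEquiv x.1).1 (bitEquiv x.2).1 * F x.1 x.2) ⊆ Set.range φ := by
    intro x hx
    by_contra hr
    refine hx ?_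
    have : ¬ Even (x.1 + x.2 + (shiftBit k : ℤ)) := by
      rintro ⟨v, hv⟩
      refine hr ⟨(v - (shiftBit k : ℤ), v - (shiftBit k : ℤ) - x.1), ?_⟩
      ext <;> simp only [φ] <;> omega
    simp only [pauli_bitEquiv]
    rw [if_neg this, zero_mul]
  have hF2 := hF.comp_injective hφ
  rw [← hφ.tsum_eq hsupp]
  have hterm (x : ℤ × ℤ) : pauli k (bitEquiv (φ x).1).1 (bitEquiv (φ x).2).1 *
      F (φ x).1 (φ x).2 = A (2 * x.1 + (shiftBit k : ℤ)) *
        ((-I) ^ (shiftBit k * phaseBit k) * (-1) ^ (phaseBit k * (x.1 - x.2)) *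
        cexp (-Real.pi * T * ((x.2 : ℂ) + shiftBit k / 2) ^ 2
          + 2 * Real.pi * I * z (2 * x.1 + (shiftBit k : ℤ)) * ((x.2 : ℂ) + shiftBit k / 2))) := by
    have he : Even ((φ x).1 + (φ x).2 + shiftBit k) := ⟨x.1 + (shiftBit k : ℤ), by
      simp only [φ]
      ring⟩
    have h1 : (φ x).1 + (φ x).2 = 2 * x.1 + (shiftBit k : ℤ) := by simp only [φ]; ring
    have h2 : (((φ x).2 : ℂ) - (φ x).1) / 2 = x.2 + shiftBit k / 2 := by
      simp only [φ]
      push_cast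
      ring
    rw [pauli_bitEquiv, if_pos he, hFA, h1, h2]
    ring
  simp only [Function.comp_def, hterm] at hF2 ⊢
  rw [hF2.tsum_prod, ← tsum_mul_left, ← (cosetEquiv k).tsum_eq, Complex.ofReal_tsum]
  have hs2 := (Complex.ofRealCLM.summable (hs.mul_left (ySign k)))
  rw [← (cosetEquiv k).summable_iff] at hs2
  have hterm2 (x : ℤ × ℤ) : ((ySign k * (sgn k (cosetEquiv k x) * G (cosetEquiv k x)) : ℝ) : ℂ) =
      A (2 * x.1 + (shiftBit k : ℤ)) * ((-1) ^ (phaseBit k * x.1 + shiftBit k * x.2) *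
        (1 / (√T : ℂ) *
          cexp (-(Real.pi / T) *
            ((x.2 : ℂ) + phaseBit k / 2 - z (2 * x.1 + (shiftBit k : ℤ))) ^ 2))) := by
    rw [← mul_assoc]
    have h := ySign_mul_sgn k x.1 x.2
    simp only [cosetEquiv, Equiv.coe_fn_mk] at h ⊢
    rw [h]
    rw [ofReal_mul, hG]
    push_cast
    rw [show (2 * (x.2 : ℂ) + phaseBit k) / 2 = x.2 + phaseBit k / 2 by ring]
    ring
  simp only [Function.comp_def, Complex.ofRealCLM_apply, hterm2] at hs2 ⊢
  rw [hs2.tsum_prod]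
  refine tsum_congr fun u => ?_
  simp only [tsum_mul_left, tsum_pauli_fiber k hT]


/-! ### Codeword wave functions -/

theorem tanh_pos {ε : ℝ} (hε : 0 < ε) : 0 < Real.tanh ε := by
  rw [Real.tanh_eq_sinh_div_cosh]
  exact div_pos (Real.sinh_pos_iff.2 hε) (Real.cosh_pos ε)

theorem sech_sq (ε : ℝ) : (1 / Real.cosh ε) ^ 2 = 1 - Real.tanh ε ^ 2 := by
  have h := (Real.cosh_pos ε).ne'
  rw [Real.tanh_eq_sinh_div_cosh]
  field_simp
  linarith [Real.cosh_sq ε]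

theorem peakWidth_sq {ε : ℝ} (hε : 0 < ε) : peakWidth ε ^ 2 = Real.tanh ε / 2 :=
  Real.sq_sqrt (half_pos (tanh_pos hε)).le

/-- The peak of the codeword wave functions at the lattice point `n`. -/
def peak (ε : ℝ) (n : ℤ) (x : ℝ) : ℝ :=
  Real.exp (-(x - n * (1 / Real.cosh ε * √Real.pi)) ^ 2 / (2 * Real.tanh ε)
    - Real.pi * Real.tanh ε * n ^ 2 / 2)

theorem gkpPeak_eq {ε : ℝ} (hε : 0 < ε) (μ : Fin 2) (s : ℤ) (x : ℝ) :
    gkpPeak ε μ s x = peak ε (2 * s + (μ : ℕ)) x := by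
  have ht := (tanh_pos hε).ne'
  have hc := (Real.cosh_pos ε).ne'
  rw [gkpPeak, peak, mul_pow _ (√Real.pi), Real.sq_sqrt Real.pi_pos.le]
  congr 1
  push_cast
  field_simp
  ring

theorem continuous_gkpPeak (ε : ℝ) (μ : Fin 2) (s : ℤ) : Continuous (gkpPeak ε μ s) := by
  unfold gkpPeak
  fun_prop

theorem gkpPeak_pos (ε : ℝ) (μ : Fin 2) (s : ℤ) (x : ℝ) : 0 < gkpPeak ε μ s x := Real.exp_pos _

/-- The geometric majorant of the peak amplitudes. -/
def peakBound (ε : ℝ) (s : ℤ) : ℝ := Real.exp (-(Real.tanh ε / 4)) ^ s.natAbs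

theorem peakBound_nonneg (ε : ℝ) (s : ℤ) : 0 ≤ peakBound ε s := by
  unfold peakBound
  positivity

theorem gkpPeak_le_peakBound {ε : ℝ} (hε : 0 < ε) (μ : Fin 2) (s : ℤ) (x : ℝ) :
    gkpPeak ε μ s x ≤ peakBound ε s :=
  (gkpPeak_le hε μ s x).trans (mul_le_of_le_one_left (peakBound_nonneg ε s)
    (Real.exp_le_one_iff.2 (by nlinarith [tanh_pos hε, sq_nonneg x])))

theorem summable_gkpPeak {ε : ℝ} (hε : 0 < ε) (μ : Fin 2) (x : ℝ) :
    Summable fun s => gkpPeak ε μ s x :=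
  (summable_gkpPeak_bound hε).of_nonneg_of_le (fun s => (gkpPeak_pos ε μ s x).le)
    fun s => gkpPeak_le_peakBound hε μ s x

/-- The prefactor `(√π tanh ε)^{-1/2}` of the codeword wave functions. -/
def waveNorm (ε : ℝ) : ℝ := 1 / √(√Real.pi * Real.tanh ε)

theorem waveNorm_sq {ε : ℝ} (hε : 0 < ε) : waveNorm ε ^ 2 = 1 / (√Real.pi * Real.tanh ε) := by
  have := tanh_pos hε
  rw [waveNorm, div_pow, one_pow, Real.sq_sqrt (by positivity)]

theorem waveNorm_nonneg (ε : ℝ) : 0 ≤ waveNorm ε := by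
  unfold waveNorm
  positivity

theorem hasSum_gkpWave {ε : ℝ} (hε : 0 < ε) (μ : Fin 2) (x : ℝ) :
    HasSum (fun s => ((waveNorm ε * gkpPeak ε μ s x : ℝ) : ℂ)) (gkpWave ε μ x) :=
  Complex.hasSum_ofReal.2 ((summable_gkpPeak hε μ x).hasSum.mul_left _)

theorem continuous_gkpWave {ε : ℝ} (hε : 0 < ε) (μ : Fin 2) : Continuous (gkpWave ε μ) := by
  refine Complex.continuous_ofReal.comp (continuous_const.mul ?_)
  refine continuous_tsum (continuous_gkpPeak ε μ) (summable_gkpPeak_bound hε) fun s x => ?_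
  rw [Real.norm_of_nonneg (gkpPeak_pos ε μ s x).le]
  exact gkpPeak_le_peakBound hε μ s x

theorem exists_norm_gkpWave_le {ε : ℝ} (hε : 0 < ε) (μ : Fin 2) :
    ∃ C, 0 ≤ C ∧ ∀ x, ‖gkpWave ε μ x‖ ≤ C * Real.exp (-(Real.tanh ε / 8) * x ^ 2) := by
  refine ⟨waveNorm ε * ∑' s, peakBound ε s,
    mul_nonneg (waveNorm_nonneg ε) (tsum_nonneg (peakBound_nonneg ε)), fun x => ?_⟩
  rw [gkpWave, Complex.norm_real, ← waveNorm, Real.norm_of_nonneg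
    (mul_nonneg (waveNorm_nonneg ε) (tsum_nonneg fun s => (gkpPeak_pos ε μ s x).le)), mul_assoc]
  refine mul_le_mul_of_nonneg_left ?_ (waveNorm_nonneg ε)
  rw [mul_comm, ← tsum_mul_left]
  exact (summable_gkpPeak hε μ x).tsum_le_tsum (gkpPeak_le hε μ · x)
    ((summable_gkpPeak_bound hε).mul_left _)

theorem conj_gkpWave (ε : ℝ) (μ : Fin 2) (x : ℝ) :
    (starRingEnd ℂ) (gkpWave ε μ x) = gkpWave ε μ x := Complex.conj_ofReal _

/-! ### Weights -/

theorem weight_pos (ε : ℝ) (m : ℤ × ℤ) : 0 < weight ε m := Real.exp_pos _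

theorem summable_weight {ε : ℝ} (hε : 0 < ε) : Summable (weight ε) := by
  have ht := tanh_pos hε
  have h1 : Summable fun n : ℤ => Real.exp (-(Real.pi / 4) * Real.tanh ε * (n : ℝ) ^ 2) := by
    -- The geometric majorant of the peaks serves again, since |n| ≤ n² ≤ πn².
    refine (summable_gkpPeak_bound hε).of_nonneg_of_le (fun n => (Real.exp_pos _).le)
      fun n => ?_
    rw [← Real.exp_nat_mul, Real.exp_le_exp]
    have h : (n.natAbs : ℝ) ≤ (n : ℝ) ^ 2 := by
      have := Int.le_self_sq |n|
      rw [sq_abs] at this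
      rw [Nat.cast_natAbs]
      exact_mod_cast this
    have h3 : (n : ℝ) ^ 2 ≤ Real.pi * (n : ℝ) ^ 2 := by
      nlinarith [Real.pi_gt_three, sq_nonneg (n : ℝ)]
    nlinarith [mul_le_mul_of_nonneg_left (h.trans h3) ht.le]
  refine (h1.mul_of_nonneg h1 (fun _ => (Real.exp_pos _).le)
    fun _ => (Real.exp_pos _).le).congr fun m => ?_
  rw [weight, ← Real.exp_add]
  congr 1
  ring

theorem summable_weight_mul {ε : ℝ} (hε : 0 < ε) (k : Fin 4) {g : ℤ × ℤ → ℝ} {C : ℝ}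
    (hg : ∀ m, |g m| ≤ C) : Summable fun m : coset k => |weight ε m * sgn k m * g m| := by
  refine (((summable_weight hε).mul_left C).comp_injective
    (Subtype.val_injective (p := (· ∈ coset k)))).of_nonneg_of_le
    (fun _ => abs_nonneg _) fun m => ?_
  rw [abs_mul, abs_mul, abs_sgn, mul_one, abs_of_pos (weight_pos ε m), Function.comp_apply,
    mul_comm C]
  exact mul_le_mul_of_nonneg_left (hg m) (weight_pos ε m).le

theorem abs_latticeGaussian_le (ε : ℝ) (m : ℤ × ℤ) (q p : ℝ) :
    |latticeGaussian ε m q p| ≤ 1 / (2 * Real.pi * peakWidth ε ^ 2) := by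
  unfold latticeGaussian
  rw [abs_of_nonneg (by positivity)]
  refine mul_le_of_le_one_right (by positivity) (Real.exp_le_one_iff.2 ?_)
  rw [neg_div]
  exact neg_nonpos.2 (by positivity)

/-! ### The position kernel -/

/-- The continuous position kernel of `σ_k^ε`. -/
def pauliKernel (ε : ℝ) (k : Fin 4) (x y : ℝ) : ℂ :=
  ∑ μ, ∑ ν, pauli k μ ν * (gkpWave ε μ x * gkpWave ε ν y)

theorem inner_gkpKet_left {ε : ℝ} (hε : 0 < ε) (ν : Fin 2) (f : Mode) :
    Integrable (fun y => gkpWave ε ν y * f y) ∧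
      inner ℂ (gkpKet hε ν) f = ∫ y, gkpWave ε ν y * f y := by
  refine ⟨(memLp_gkpWave hε ν).integrable_mul (Lp.memLp f), ?_⟩
  rw [L2.inner_def]
  refine integral_congr_ae ?_
  filter_upwards [(memLp_gkpWave hε ν).coeFn_toLp] with x hx
  rw [gkpKet, hx]
  simp [conj_gkpWave, mul_comm]

theorem hasPositionKernel_gkpPauli {ε : ℝ} (hε : 0 < ε) (k : Fin 4) :
    HasPositionKernel (gkpPauli hε k) (pauliKernel ε k) := by
  constructor
  · unfold Function.uncurry pauliKernel
    have h := continuous_gkpWave hε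
    fun_prop
  · intro f
    have hA : gkpPauli hε k f =ᵐ[volume] fun x =>
        ∑ μ, ∑ ν, (pauli k μ ν * inner ℂ (gkpKet hε ν) f) * gkpWave ε μ x := by
      rw [gkpPauli_apply]
      simp only [← Finset.sum_smul, ← Finset.sum_mul]
      rw [Fin.sum_univ_two]
      filter_upwards [Lp.coeFn_add
          ((∑ ν, pauli k 0 ν * inner ℂ (gkpKet hε ν) f) • gkpKet hε 0)
          ((∑ ν, pauli k 1 ν * inner ℂ (gkpKet hε ν) f) • gkpKet hε 1),
        Lp.coeFn_smul (∑ ν, pauli k 0 ν * inner ℂ (gkpKet hε ν) f) (gkpKet hε 0),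
        Lp.coeFn_smul (∑ ν, pauli k 1 ν * inner ℂ (gkpKet hε ν) f) (gkpKet hε 1),
        (memLp_gkpWave hε 0).coeFn_toLp, (memLp_gkpWave hε 1).coeFn_toLp] with x h1 h2 h3 h4 h5
      rw [h1, Pi.add_apply, h2, h3, Pi.smul_apply, Pi.smul_apply, Fin.sum_univ_two (f := fun μ =>
        (∑ ν, pauli k μ ν * inner ℂ (gkpKet hε ν) f) * gkpWave ε μ x), gkpKet, gkpKet, h4, h5]
      rfl
    filter_upwards [hA] with x hx
    have e : (fun y => pauliKernel ε k x y * f y) = fun y =>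
        ∑ μ, ∑ ν, (pauli k μ ν * gkpWave ε μ x) * (gkpWave ε ν y * f y) := by
      ext y
      simp only [pauliKernel, Finset.sum_mul]
      exact Finset.sum_congr rfl fun μ _ => Finset.sum_congr rfl fun ν _ => by ring
    have hi (μ ν : Fin 2) : Integrable
        (fun y => (pauli k μ ν * gkpWave ε μ x) * (gkpWave ε ν y * f y)) :=
      (inner_gkpKet_left hε ν f).1.const_mul _
    rw [e, hx]
    refine ⟨integrable_finsetSum _ fun μ _ => integrable_finsetSum _ fun ν _ => hi μ ν, ?_⟩
    rw [integral_finsetSum _ fun μ _ => integrable_finsetSum _ fun ν _ => hi μ ν]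
    refine Finset.sum_congr rfl fun μ _ => ?_
    rw [integral_finsetSum _ fun ν _ => hi μ ν]
    refine Finset.sum_congr rfl fun ν _ => ?_
    rw [integral_const_mul, (inner_gkpKet_left hε ν f).2]
    ring

/-! ### The Wigner function -/

/-- A Gaussian integral in y. Writing n² + n'² through the sum and the difference separates the
exponent into the form needed for resummation, with T = tanh ε; the relation between sech and tanh
is not yet needed. -/
theorem integral_peak_mul_peak {ε : ℝ} (hε : 0 < ε) (n n' : ℤ) (q p : ℝ) :
    ∫ y : ℝ, cexp (I * p * y) * (peak ε n (q - y / 2) * peak ε n' (q + y / 2) : ℝ) =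
      (2 * √(Real.pi * Real.tanh ε) * Real.exp (-(2 * q - (n + n' : ℤ) *
        (1 / Real.cosh ε * √Real.pi)) ^ 2 / (4 * Real.tanh ε) - Real.tanh ε * p ^ 2
        - Real.pi * Real.tanh ε * (n + n' : ℤ) ^ 2 / 4) : ℝ) *
      cexp (-Real.pi * (Real.tanh ε) * (((n' : ℂ) - n) / 2) ^ 2
      + 2 * Real.pi * I * (p * (1 / Real.cosh ε * √Real.pi) / Real.pi : ℝ)
        * (((n' : ℂ) - n) / 2)) := by
  have ht := tanh_pos hε
  unfold peak
  generalize 1 / Real.cosh ε * √Real.pi = a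
  generalize Real.tanh ε = t at *
  have htC : (t : ℂ) ≠ 0 := ofReal_ne_zero.2 ht.ne'
  have hπC : (Real.pi : ℂ) ≠ 0 := ofReal_ne_zero.2 Real.pi_ne_zero
  have h := integral_cexp_quadratic (b := ((-(1 / (4 * t)) : ℝ) : ℂ))
    (by rw [ofReal_re]; exact neg_neg_of_pos (by positivity))
    (I * p + (n' - n) * a / (2 * t))
    (-((q - n * a) ^ 2 + (q - n' * a) ^ 2) / (2 * t) - Real.pi * t * (n ^ 2 + n' ^ 2) / 2)
  have e1 (y : ℝ) : cexp (I * p * y) *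
      (Real.exp (-(q - y / 2 - n * a) ^ 2 / (2 * t) - Real.pi * t * n ^ 2 / 2) *
        Real.exp (-(q + y / 2 - n' * a) ^ 2 / (2 * t) - Real.pi * t * n' ^ 2 / 2) : ℝ) =
      cexp (((-(1 / (4 * t)) : ℝ) : ℂ) * y ^ 2 + (I * p + (n' - n) * a / (2 * t)) * y +
        (-((q - n * a) ^ 2 + (q - n' * a) ^ 2) / (2 * t)
          - Real.pi * t * (n ^ 2 + n' ^ 2) / 2)) := by
    rw [← Real.exp_add, ofReal_exp, ← Complex.exp_add]
    congr 1
    push_cast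
    field_simp
    ring
  have e2 : ((Real.pi : ℂ) / -((-(1 / (4 * t)) : ℝ) : ℂ)) ^ (1 / 2 : ℂ) =
      ((2 * √(Real.pi * t) : ℝ) : ℂ) := by
    have : (Real.pi : ℂ) / -((-(1 / (4 * t)) : ℝ) : ℂ) = ((2 ^ 2 * (Real.pi * t) : ℝ) : ℂ) := by
      push_cast
      field_simp
      norm_num
    rw [this, show (1 / 2 : ℂ) = ((1 / 2 : ℝ) : ℂ) by push_cast; rfl,
      ← Complex.ofReal_cpow (by positivity), ← Real.sqrt_eq_rpow,
      Real.sqrt_mul (by positivity), Real.sqrt_sq (by positivity)]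
  simp_rw [e1]
  rw [h, e2, ofReal_mul _ (Real.exp _), ofReal_exp, mul_assoc ((2 * √(Real.pi * t) : ℝ) : ℂ),
    ← Complex.exp_add]
  congr 2
  push_cast
  field_simp
  ring_nf
  simp only [I_sq]
  ring

/-- Completing the square in m₂ puts the summand in the shape A(m₁) times a dual Gaussian. Here
sech² = 1 - tanh² is what makes envelope and peak width fit together. -/
theorem weight_mul_latticeGaussian {ε : ℝ} (hε : 0 < ε) (m₁ m₂ : ℤ) (q p : ℝ) :
    weight ε (m₁, m₂) * latticeGaussian ε (m₁, m₂) q p =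
      waveNorm ε ^ 2 / (2 * Real.pi) * (2 * √(Real.pi * Real.tanh ε) *
        Real.exp (-(2 * q - m₁ *
        (1 / Real.cosh ε * √Real.pi)) ^ 2 / (4 * Real.tanh ε) - Real.tanh ε * p ^ 2
        - Real.pi * Real.tanh ε * m₁ ^ 2 / 4)) *
      (1 / √(Real.tanh ε) * Real.exp (-(Real.pi / Real.tanh ε) *
        ((m₂ : ℝ) / 2 - p * (1 / Real.cosh ε * √Real.pi) / Real.pi) ^ 2)) := by
  have ht := tanh_pos hε
  have hc := sech_sq ε
  rw [weight, latticeGaussian, peakWidth_sq hε, waveNorm_sq hε, Real.sqrt_mul Real.pi_pos.le]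
  have hw : √Real.pi ^ 2 = Real.pi := Real.sq_sqrt Real.pi_pos.le
  have hw0 : 0 < √Real.pi := Real.sqrt_pos.2 Real.pi_pos
  have hs0 : 0 < √(Real.tanh ε) := Real.sqrt_pos.2 ht
  generalize √(Real.tanh ε) = s at *
  generalize 1 / Real.cosh ε = c at *
  generalize Real.tanh ε = t at *
  generalize √Real.pi = w at *
  generalize Real.pi = P at *
  subst hw
  have e : -(w ^ 2 / 4) * t * ((m₁ : ℝ) ^ 2 + (m₂ : ℝ) ^ 2) +
      -((q - c * (w / 2) * m₁) ^ 2 + (p - c * (w / 2) * m₂) ^ 2) / (2 * (t / 2)) =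
      -(2 * q - m₁ * (c * w)) ^ 2 / (4 * t) - t * p ^ 2 - w ^ 2 * t * m₁ ^ 2 / 4 +
      -(w ^ 2 / t) * ((m₂ : ℝ) / 2 - p * (c * w) / w ^ 2) ^ 2 := by
    field_simp
    linear_combination (16 * p ^ 2 - 4 * w ^ 2 * m₂ ^ 2) * hc
  have l : Real.exp (-(w ^ 2 / 4) * t * ((m₁ : ℝ) ^ 2 + (m₂ : ℝ) ^ 2)) *
      (1 / (2 * w ^ 2 * (t / 2)) *
        Real.exp (-((q - c * (w / 2) * m₁) ^ 2 + (p - c * (w / 2) * m₂) ^ 2) / (2 * (t / 2)))) =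
      1 / (w ^ 2 * t) * Real.exp (-(w ^ 2 / 4) * t * ((m₁ : ℝ) ^ 2 + (m₂ : ℝ) ^ 2) +
      -((q - c * (w / 2) * m₁) ^ 2 + (p - c * (w / 2) * m₂) ^ 2) / (2 * (t / 2))) := by
    rw [Real.exp_add]
    field_simp
  simp only
  rw [l, e, Real.exp_add]
  field_simp

/-! ### Double series over pairs of peaks and termwise integration of the kernel. -/

theorem norm_pauli_le (k : Fin 4) (μ ν : Fin 2) : ‖pauli k μ ν‖ ≤ 1 := by
  fin_cases k <;> fin_cases μ <;> fin_cases ν <;> simp [pauli]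

theorem summable_fin_prod {f : Fin 2 × ℤ → ℝ} (h0 : 0 ≤ f)
    (h : ∀ μ, Summable fun s => f (μ, s)) : Summable f :=
  (summable_prod_of_nonneg h0).2 ⟨h, (hasSum_fintype _).summable⟩

theorem hasSum_pauli_mul {k : Fin 4} {f g : Fin 2 → ℤ → ℂ} {a b : Fin 2 → ℂ}
    (hf : ∀ μ, HasSum (f μ) (a μ)) (hf' : ∀ μ, Summable fun s => ‖f μ s‖)
    (hg : ∀ μ, HasSum (g μ) (b μ)) (hg' : ∀ μ, Summable fun s => ‖g μ s‖) :
    HasSum (fun j : (Fin 2 × ℤ) × (Fin 2 × ℤ) => pauli k j.1.1 j.2.1 *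
      (f j.1.1 j.1.2 * g j.2.1 j.2.2)) (∑ μ, ∑ ν, pauli k μ ν * (a μ * b ν)) := by
  have h (μ ν : Fin 2) : HasSum (fun x : ℤ × ℤ => pauli k μ ν * (f μ x.1 * g ν x.2))
      (pauli k μ ν * (a μ * b ν)) :=
    ((hf μ).mul (hg ν) (summable_mul_of_summable_norm (hf' μ) (hg' ν))).mul_left _
  have hsum : Summable (fun j : (Fin 2 × ℤ) × (Fin 2 × ℤ) => pauli k j.1.1 j.2.1 *
      (f j.1.1 j.1.2 * g j.2.1 j.2.2)) := by
    refine .of_norm_bounded ((summable_fin_prod (f := fun x => ‖f x.1 x.2‖)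
      (fun _ => norm_nonneg _) hf').mul_of_nonneg (summable_fin_prod (f := fun x => ‖g x.1 x.2‖)
      (fun _ => norm_nonneg _) hg') (fun _ => norm_nonneg _) fun _ => norm_nonneg _) fun j => ?_
    rw [norm_mul, norm_mul]
    exact mul_le_of_le_one_left (by positivity) (norm_pauli_le _ _ _)
  let e : ((Fin 2 × Fin 2) × (ℤ × ℤ)) ≃ (Fin 2 × ℤ) × (Fin 2 × ℤ) :=
    Equiv.prodProdProdComm _ _ _ _
  have hs := (e.summable_iff.2 hsum).hasSum
  have h2 := hs.prod_fiberwise (g := fun p : Fin 2 × Fin 2 => pauli k p.1 p.2 * (a p.1 * b p.2))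
    fun p => h p.1 p.2
  have h3 := h2.unique (hasSum_fintype _)
  rw [Fintype.sum_prod_type] at h3
  exact hsum.hasSum_iff.2 ((e.hasSum_iff.1 hs).tsum_eq.trans h3)

theorem summable_norm_gkpWave {ε : ℝ} (hε : 0 < ε) (μ : Fin 2) (x : ℝ) :
    Summable fun s => ‖((waveNorm ε * gkpPeak ε μ s x : ℝ) : ℂ)‖ := by
  refine ((summable_gkpPeak hε μ x).mul_left (waveNorm ε)).congr fun s => ?_
  rw [Complex.norm_real, Real.norm_of_nonneg
    (mul_nonneg (waveNorm_nonneg ε) (gkpPeak_pos ε μ s x).le)]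

theorem integrable_pauliKernel {ε : ℝ} (hε : 0 < ε) (k : Fin 4) (q p : ℝ) :
    Integrable fun y : ℝ => cexp (I * p * y) * pauliKernel ε k (q - y / 2) (q + y / 2) := by
  have ht := tanh_pos hε
  have hc := continuous_gkpWave hε
  have h (μ ν : Fin 2) : Integrable fun y : ℝ =>
      cexp (I * p * y) * (pauli k μ ν * (gkpWave ε μ (q - y / 2) * gkpWave ε ν (q + y / 2))) := by
    obtain ⟨C, hC0, hC⟩ := exists_norm_gkpWave_le hε μ
    obtain ⟨D, hD0, hD⟩ := exists_norm_gkpWave_le hε ν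
    -- Since (q - y/2)² + (q + y/2)² = 2q² + y²/2, two factors of rate tanh ε / 8 leave rate tanh ε
    -- / 16 in y.
    refine ((integrable_exp_neg_mul_sq (b := Real.tanh ε / 16) (by positivity)).const_mul
      (C * D)).mono' (by fun_prop) (Filter.Eventually.of_forall fun y => ?_)
    rw [norm_mul, norm_mul, norm_mul, mul_comm I, mul_right_comm, ← ofReal_mul,
      Complex.norm_exp_ofReal_mul_I, one_mul]
    calc _ ≤ 1 * ((C * Real.exp (-(Real.tanh ε / 8) * (q - y / 2) ^ 2)) *
          (D * Real.exp (-(Real.tanh ε / 8) * (q + y / 2) ^ 2))) :=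
          mul_le_mul (norm_pauli_le _ _ _) (mul_le_mul (hC _) (hD _) (norm_nonneg _)
            (by positivity)) (by positivity) zero_le_one
      _ = C * D * Real.exp (-(Real.tanh ε / 8) * (q - y / 2) ^ 2 +
          -(Real.tanh ε / 8) * (q + y / 2) ^ 2) := by
          rw [Real.exp_add]
          ring
      _ ≤ _ := by
          refine mul_le_mul_of_nonneg_left (Real.exp_le_exp.2 ?_) (by positivity)
          nlinarith [mul_nonneg ht.le (sq_nonneg q)]
  simp only [pauliKernel, Finset.mul_sum]
  exact integrable_finsetSum _ fun μ _ => integrable_finsetSum _ fun ν _ => h μ ν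

/-- Each pair of peaks is dominated by a summable constant `B j` times one integrable Gaussian `g`,
so sum and integral commute; `tsum_pauli_resummation` then applies with T = tanh ε. -/
theorem integral_pauliKernel {ε : ℝ} (hε : 0 < ε) (k : Fin 4) (q p : ℝ) :
    1 / (2 * Real.pi) * ∫ y : ℝ, cexp (I * p * y) * pauliKernel ε k (q - y / 2) (q + y / 2) =
      ((ySign k * ∑' m : coset k, weight ε m * sgn k m * latticeGaussian ε m q p : ℝ) : ℂ) := by
  have ht := tanh_pos hε
  let H : (Fin 2 × ℤ) × (Fin 2 × ℤ) → ℝ → ℂ := fun j y => cexp (I * p * y) *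
    (pauli k j.1.1 j.2.1 * (((waveNorm ε * gkpPeak ε j.1.1 j.1.2 (q - y / 2) : ℝ) : ℂ) *
      ((waveNorm ε * gkpPeak ε j.2.1 j.2.2 (q + y / 2) : ℝ) : ℂ)))
  have hsum (y : ℝ) : ∑' j, H j y =
      cexp (I * p * y) * pauliKernel ε k (q - y / 2) (q + y / 2) := by
    simp only [H]
    rw [tsum_mul_left]
    congr 1
    exact (hasSum_pauli_mul (fun μ => hasSum_gkpWave hε μ _)
      (fun μ => summable_norm_gkpWave hε μ _) (fun μ => hasSum_gkpWave hε μ _)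
      (fun μ => summable_norm_gkpWave hε μ _)).tsum_eq
  let B : (Fin 2 × ℤ) × (Fin 2 × ℤ) → ℝ := fun j => peakBound ε j.1.2 * peakBound ε j.2.2
  have hB : Summable B := by
    have h : Summable fun x : Fin 2 × ℤ => peakBound ε x.2 :=
      summable_fin_prod (fun x => peakBound_nonneg ε x.2) fun μ => summable_gkpPeak_bound hε
    exact h.mul_of_nonneg h (fun x => peakBound_nonneg ε x.2) fun x => peakBound_nonneg ε x.2
  let g : ℝ → ℝ := fun y => waveNorm ε ^ 2 * Real.exp (-(Real.tanh ε / 16) * y ^ 2)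
  have hg : Integrable g :=
    (integrable_exp_neg_mul_sq (b := Real.tanh ε / 16) (by positivity)).const_mul _
  have hle (j) (y : ℝ) : ‖H j y‖ ≤ B j * g y := by
    have h1 := gkpPeak_le hε j.1.1 j.1.2 (q - y / 2)
    have h2 := gkpPeak_le hε j.2.1 j.2.2 (q + y / 2)
    have hw := waveNorm_nonneg ε
    simp only [H]
    rw [norm_mul, norm_mul, norm_mul, mul_comm I, mul_right_comm, ← ofReal_mul,
      Complex.norm_exp_ofReal_mul_I, one_mul, Complex.norm_real, Complex.norm_real,
      Real.norm_of_nonneg (mul_nonneg hw (gkpPeak_pos ε _ _ _).le),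
      Real.norm_of_nonneg (mul_nonneg hw (gkpPeak_pos ε _ _ _).le)]
    refine (mul_le_of_le_one_left (mul_nonneg (mul_nonneg hw (gkpPeak_pos ε _ _ _).le)
      (mul_nonneg hw (gkpPeak_pos ε _ _ _).le)) (norm_pauli_le _ _ _)).trans ?_
    calc _ = waveNorm ε ^ 2 * (gkpPeak ε j.1.1 j.1.2 (q - y / 2) *
          gkpPeak ε j.2.1 j.2.2 (q + y / 2)) := by ring
      _ ≤ waveNorm ε ^ 2 * ((Real.exp (-(Real.tanh ε / 8) * (q - y / 2) ^ 2) * peakBound ε j.1.2) *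
          (Real.exp (-(Real.tanh ε / 8) * (q + y / 2) ^ 2) * peakBound ε j.2.2)) :=
          mul_le_mul_of_nonneg_left (mul_le_mul h1 h2 (gkpPeak_pos ε _ _ _).le
            (mul_nonneg (Real.exp_pos _).le (peakBound_nonneg ε _))) (by positivity)
      _ = B j * (waveNorm ε ^ 2 * Real.exp (-(Real.tanh ε / 8) * (q - y / 2) ^ 2 +
          -(Real.tanh ε / 8) * (q + y / 2) ^ 2)) := by
          simp only [B, Real.exp_add]
          ring
      _ ≤ _ := by
          refine mul_le_mul_of_nonneg_left (mul_le_mul_of_nonneg_left (Real.exp_le_exp.2 ?_)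
            (by positivity)) (mul_nonneg (peakBound_nonneg ε _) (peakBound_nonneg ε _))
          nlinarith [mul_nonneg ht.le (sq_nonneg q)]
  have hHi (j) : Integrable (H j) := by
    refine (hg.const_mul (B j)).mono' ?_ (Filter.Eventually.of_forall (hle j))
    have h1 := continuous_gkpPeak ε j.1.1 j.1.2
    have h2 := continuous_gkpPeak ε j.2.1 j.2.2
    exact Continuous.aestronglyMeasurable (by fun_prop)
  have hHs : Summable fun j => ∫ y, ‖H j y‖ := by
    refine (hB.mul_right (∫ y, g y)).of_nonneg_of_le
      (fun j => integral_nonneg fun y => norm_nonneg _) fun j => ?_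
    rw [← integral_const_mul]
    exact integral_mono (hHi j).norm (hg.const_mul _) (hle j)
  have hH := hasSum_integral_of_summable_integral_norm hHi hHs
  simp only [hsum] at hH
  have hH2 := hH.mul_left (1 / (2 * Real.pi) : ℂ)
  let F : ℤ → ℤ → ℂ := fun n n' => ((waveNorm ε ^ 2 / (2 * Real.pi) : ℝ) : ℂ) *
    ∫ y : ℝ, cexp (I * p * y) * (peak ε n (q - y / 2) * peak ε n' (q + y / 2) : ℝ)
  have hF (j : (Fin 2 × ℤ) × (Fin 2 × ℤ)) : 1 / (2 * Real.pi) * ∫ y, H j y =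
      pauli k j.1.1 j.2.1 * F (2 * j.1.2 + (j.1.1 : ℕ)) (2 * j.2.2 + (j.2.1 : ℕ)) := by
    simp only [F, H, ← gkpPeak_eq hε]
    rw [← integral_const_mul, ← integral_const_mul, ← integral_const_mul]
    congr 1
    ext y
    push_cast
    ring
  simp only [hF] at hH2
  rw [← hH2.tsum_eq]
  refine (tsum_pauli_resummation k ht (G := fun m => weight ε m * latticeGaussian ε m q p)
    (A := fun m₁ => ((waveNorm ε ^ 2 / (2 * Real.pi) * (2 * √(Real.pi * Real.tanh ε) *
        Real.exp (-(2 * q - m₁ *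
        (1 / Real.cosh ε * √Real.pi)) ^ 2 / (4 * Real.tanh ε) - Real.tanh ε * p ^ 2
        - Real.pi * Real.tanh ε * m₁ ^ 2 / 4)) : ℝ) : ℂ))
    (z := fun _ => p * (1 / Real.cosh ε * √Real.pi) / Real.pi)
    hH2.summable ?_ ?_ ?_).trans ?_
  · intro n n'
    simp only [F]
    rw [integral_peak_mul_peak hε, ofReal_mul (waveNorm ε ^ 2 / (2 * Real.pi))]
    exact (mul_assoc _ _ _).symm
  · intro m₁ m₂
    rw [weight_mul_latticeGaussian hε, ofReal_mul, ofReal_mul (1 / √(Real.tanh ε)), ofReal_exp]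
    push_cast
    rfl
  · refine ((summable_weight_mul hε k (abs_latticeGaussian_le ε · q p)).of_abs).congr fun m => ?_
    ring
  · congr 2
    exact tsum_congr fun m => by ring

theorem hasWignerFunction_gkpPauli {ε : ℝ} (hε : 0 < ε) (k : Fin 4) :
    HasWignerFunction (gkpPauli hε k) (fun q p =>
      ((ySign k * ∑' m : coset k, weight ε m * sgn k m * latticeGaussian ε m q p : ℝ) : ℂ)) :=
  ⟨pauliKernel ε k, hasPositionKernel_gkpPauli hε k, fun q p =>
    ⟨integrable_pauliKernel hε k q p, (integral_pauliKernel hε k q p).symm⟩⟩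


/-! ### Wave functions of the rotated quadratures -/

/-- The scale factor of `quadratureValue`. -/
def quadratureScale (θ : ℝ) : ℝ :=
  if Real.sin θ = 0 then Real.cos θ else 2 * Real.pi * Real.sin θ

theorem quadratureValue_eq (θ ξ : ℝ) : quadratureValue θ ξ = quadratureScale θ * ξ := by
  unfold quadratureValue quadratureScale
  split_ifs <;> rfl

theorem quadratureScale_ne_zero (θ : ℝ) : quadratureScale θ ≠ 0 := by
  unfold quadratureScale
  split_ifs with h
  · intro h'
    have := Real.sin_sq_add_cos_sq θ
    rw [h, h'] at this
    norm_num at this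
  · have := Real.pi_ne_zero
    positivity

/-- The image of a peak under `quadratureRep θ`. -/
def rotatedPeak (ε θ : ℝ) (n : ℤ) (ξ : ℝ) : ℂ :=
  if Real.sin θ = 0 then (peak ε n ξ : ℂ)
  else ∫ x : ℝ, cexp ((-2 * Real.pi * x * ξ : ℝ) * I) * (chirp θ x * peak ε n x)

/-- The wave function of the codeword `|μ_L^ε⟩` in the representation `quadratureRep θ`. -/
def rotatedWave (ε θ : ℝ) (μ : Fin 2) (ξ : ℝ) : ℂ :=
  ∑' s : ℤ, waveNorm ε * rotatedPeak ε θ (2 * s + (μ : ℕ)) ξ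

theorem norm_fourier_kernel_mul_chirp_le (θ x ξ : ℝ) (r : ℂ) :
    ‖cexp ((-2 * Real.pi * x * ξ : ℝ) * I) * (chirp θ x * r)‖ ≤ ‖r‖ := by
  rw [norm_mul, norm_mul, Complex.norm_exp_ofReal_mul_I, one_mul]
  exact mul_le_of_le_one_left (norm_nonneg _) (norm_chirp_le θ x)

theorem continuous_chirp (θ : ℝ) : Continuous (chirp θ) := by
  unfold chirp
  fun_prop

theorem integrable_gkpPeak {ε : ℝ} (hε : 0 < ε) (μ : Fin 2) (s : ℤ) :
    Integrable (gkpPeak ε μ s) ∧ ∫ x, gkpPeak ε μ s x ≤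
      (∫ x, Real.exp (-(Real.tanh ε / 8) * x ^ 2)) * peakBound ε s := by
  have ht := tanh_pos hε
  have hg := (integrable_exp_neg_mul_sq (b := Real.tanh ε / 8) (by positivity)).mul_const
    (peakBound ε s)
  have hi : Integrable (gkpPeak ε μ s) :=
    hg.mono' (continuous_gkpPeak ε μ s).aestronglyMeasurable (Filter.Eventually.of_forall fun x =>
      (Real.norm_of_nonneg (gkpPeak_pos ε μ s x).le).trans_le (gkpPeak_le hε μ s x))
  refine ⟨hi, ?_⟩
  rw [← integral_mul_const]
  exact integral_mono hi hg (gkpPeak_le hε μ s)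

theorem summable_norm_rotatedPeak {ε : ℝ} (hε : 0 < ε) (θ : ℝ) (μ : Fin 2) (ξ : ℝ) :
    Summable fun s : ℤ => ‖waveNorm ε * rotatedPeak ε θ (2 * s + (μ : ℕ)) ξ‖ := by
  simp only [norm_mul]
  refine Summable.mul_left _ ?_
  unfold rotatedPeak
  split_ifs with h
  · refine (summable_gkpPeak hε μ ξ).congr fun s => ?_
    rw [← gkpPeak_eq hε, Complex.norm_real, Real.norm_of_nonneg (gkpPeak_pos ε μ s ξ).le]
  · refine ((summable_gkpPeak_bound hε).mul_left
      (∫ x, Real.exp (-(Real.tanh ε / 8) * x ^ 2))).of_nonneg_of_le (fun _ => norm_nonneg _)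
      fun s => ?_
    simp only [← gkpPeak_eq hε]
    refine (norm_integral_le_of_norm_le (integrable_gkpPeak hε μ s).1
      (Filter.Eventually.of_forall fun x =>
        (norm_fourier_kernel_mul_chirp_le θ x ξ _).trans_eq ?_)).trans (integrable_gkpPeak hε μ s).2
    rw [Complex.norm_real, Real.norm_of_nonneg (gkpPeak_pos ε μ s x).le]

theorem fourier_chirp_mul_gkpWave {ε : ℝ} (hε : 0 < ε) {θ : ℝ} (hθ : Real.sin θ ≠ 0) (μ : Fin 2)
    (ξ : ℝ) : 𝓕 (fun x => chirp θ x * gkpWave ε μ x) ξ = rotatedWave ε θ μ ξ := by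
  let H : ℤ → ℝ → ℂ := fun s x => cexp ((-2 * Real.pi * x * ξ : ℝ) * I) *
    (chirp θ x * (waveNorm ε * gkpPeak ε μ s x : ℝ))
  have hle (s : ℤ) (x : ℝ) : ‖H s x‖ ≤ waveNorm ε * gkpPeak ε μ s x :=
    (norm_fourier_kernel_mul_chirp_le θ x ξ _).trans_eq (by
      rw [Complex.norm_real,
        Real.norm_of_nonneg (mul_nonneg (waveNorm_nonneg ε) (gkpPeak_pos ε μ s x).le)])
  have hi (s : ℤ) : Integrable (H s) := by
    refine ((integrable_gkpPeak hε μ s).1.const_mul (waveNorm ε)).mono' ?_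
      (Filter.Eventually.of_forall (hle s))
    have h1 := continuous_gkpPeak ε μ s
    have h2 := continuous_chirp θ
    exact Continuous.aestronglyMeasurable (by fun_prop)
  have hs : Summable fun s => ∫ x, ‖H s x‖ := by
    refine (((summable_gkpPeak_bound hε).mul_left
      (∫ x, Real.exp (-(Real.tanh ε / 8) * x ^ 2))).mul_left (waveNorm ε)).of_nonneg_of_le
      (fun _ => integral_nonneg fun _ => norm_nonneg _) fun s => ?_
    refine (integral_mono (hi s).norm ((integrable_gkpPeak hε μ s).1.const_mul _) (hle s)).trans ?_
    rw [integral_const_mul]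
    exact mul_le_mul_of_nonneg_left (integrable_gkpPeak hε μ s).2 (waveNorm_nonneg ε)
  have h := (hasSum_integral_of_summable_integral_norm hi hs).tsum_eq
  have e (x : ℝ) : ∑' s, H s x =
      cexp ((-2 * Real.pi * x * ξ : ℝ) * I) • (chirp θ x * gkpWave ε μ x) := by
    simp only [H, tsum_mul_left, (hasSum_gkpWave hε μ x).tsum_eq, smul_eq_mul]
  simp only [e] at h
  rw [Real.fourier_real_eq_integral_exp_smul, ← h, rotatedWave]
  refine tsum_congr fun s => ?_
  simp only [rotatedPeak, if_neg hθ, H, ← gkpPeak_eq hε]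
  rw [← integral_const_mul]
  congr 1
  ext x
  rw [ofReal_mul (waveNorm ε)]
  ring

theorem quadratureRep_gkpKet {ε : ℝ} (hε : 0 < ε) (θ : ℝ) (μ : Fin 2) :
    quadratureRep θ (gkpKet hε μ) =ᵐ[volume] rotatedWave ε θ μ := by
  by_cases hθ : Real.sin θ = 0
  · rw [quadratureRep, if_pos hθ]
    filter_upwards [(memLp_gkpWave hε μ).coeFn_toLp] with ξ hξ
    simp only [rotatedWave, rotatedPeak, if_pos hθ, ← gkpPeak_eq hε, ← ofReal_mul,
      (hasSum_gkpWave hε μ ξ).tsum_eq]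
    exact hξ
  · rw [quadratureRep, if_neg hθ]
    set g : Mode := mulOp (chirp θ) (measurable_chirp θ) (norm_chirp_le θ) (gkpKet hε μ) with hg
    have hae : g =ᵐ[volume] fun x => chirp θ x * gkpWave ε μ x := by
      filter_upwards [mulOp_coeFn (chirp θ) (measurable_chirp θ) (norm_chirp_le θ) (gkpKet hε μ),
        (memLp_gkpWave hε μ).coeFn_toLp] with x h1 h2
      rw [hg, h1, gkpKet, h2]
    have hint : Integrable g := by
      refine Integrable.congr ?_ hae.symm
      obtain ⟨C, hC0, hC⟩ := exists_norm_gkpWave_le hε μ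
      have h1 := continuous_gkpWave hε μ
      have h2 := continuous_chirp θ
      refine ((integrable_exp_neg_mul_sq (b := Real.tanh ε / 8)
        (by have := tanh_pos hε; positivity)).const_mul C).mono'
        (by fun_prop) (Filter.Eventually.of_forall fun x => ?_)
      rw [norm_mul]
      exact (mul_le_of_le_one_left (norm_nonneg _) (norm_chirp_le θ x)).trans (hC x)
    have hF : 𝓕 (g : ℝ → ℂ) = rotatedWave ε θ μ := by
      ext ξ
      rw [← fourier_chirp_mul_gkpWave hε hθ, Real.fourier_real_eq_integral_exp_smul,
        Real.fourier_real_eq_integral_exp_smul]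
      refine integral_congr_ae ?_
      filter_upwards [hae] with x hx
      rw [hx]
    rw [← hF]
    exact fourierTransformₗᵢ_ae_eq g hint

/-! ### Densities of the rotated quadratures -/

/-- The density of the centred Gaussian with variance `tanh ε / 2`. -/
def gaussDensity (ε x : ℝ) : ℝ :=
  1 / √(Real.pi * Real.tanh ε) * Real.exp (-x ^ 2 / Real.tanh ε)

/-- A Gaussian integral with complex quadratic coefficient b = -1/(2 tanh ε) + (i/2) cot θ. The
prefactor `w` does not depend on n or ξ, and only its modulus matters because peaks enter multiplied
by conjugates of peaks. -/
theorem rotatedPeak_eq {ε : ℝ} (hε : 0 < ε) {θ : ℝ} (hθ : Real.sin θ ≠ 0) :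
    ∃ w : ℂ, ‖w‖ ^ 2 = 2 * Real.pi * Real.tanh ε /
        √(1 + (Real.cos θ / Real.sin θ) ^ 2 * Real.tanh ε ^ 2) ∧ ∀ (n : ℤ) (ξ : ℝ),
      rotatedPeak ε θ n ξ = w * cexp (Real.tanh ε *
        (1 + I * (Real.cos θ / Real.sin θ : ℝ) * Real.tanh ε) /
          (2 * (1 + (Real.cos θ / Real.sin θ : ℝ) ^ 2 * Real.tanh ε ^ 2)) *
          (n * (1 / Real.cosh ε * √Real.pi : ℝ) / Real.tanh ε - I * (2 * Real.pi * ξ : ℝ)) ^ 2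
        - Real.pi * n ^ 2 / (2 * Real.tanh ε)) := by
  have ht := tanh_pos hε
  have hc := sech_sq ε
  have ha : (1 / Real.cosh ε * √Real.pi) ^ 2 = Real.pi * (1 - Real.tanh ε ^ 2) := by
    rw [mul_pow, hc, Real.sq_sqrt Real.pi_pos.le, mul_comm]
  simp only [rotatedPeak, if_neg hθ, chirp, peak]
  generalize 1 / Real.cosh ε * √Real.pi = a at *
  generalize Real.cos θ / Real.sin θ = κ at *
  generalize Real.tanh ε = t at *
  have htC : (t : ℂ) ≠ 0 := ofReal_ne_zero.2 ht.ne'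
  have hD : 0 < 1 + κ ^ 2 * t ^ 2 := by positivity
  have hDC : (1 + κ ^ 2 * t ^ 2 : ℂ) ≠ 0 := by exact_mod_cast hD.ne'
  set b : ℂ := ((-(1 / (2 * t)) : ℝ) : ℂ) + ((κ / 2 : ℝ) : ℂ) * I with hb
  have hbre : b.re = -(1 / (2 * t)) := by simp [hb]
  have hbim : b.im = κ / 2 := by simp [hb]
  have hbneg : b.re < 0 := by
    rw [hbre]
    exact neg_neg_of_pos (by positivity)
  have hb0 : b ≠ 0 := fun h => by simp [h] at hbneg
  have hbinv : -(1 / (4 * b)) = t * (1 + I * κ * t) / (2 * (1 + κ ^ 2 * t ^ 2)) := by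
    have h4 : 4 * b * (t * (1 + I * κ * t) / (2 * (1 + κ ^ 2 * t ^ 2))) = -1 := by
      rw [hb, ← mul_div_assoc, div_eq_iff (mul_ne_zero two_ne_zero hDC)]
      push_cast
      field_simp
      ring_nf
      simp only [I_sq]
      ring
    rw [← neg_div, div_eq_iff (mul_ne_zero (by norm_num) hb0), ← h4]
    ring
  refine ⟨(Real.pi / -b) ^ (1 / 2 : ℂ), ?_, fun n ξ => ?_⟩
  · rw [← norm_pow, ← Complex.cpow_nat_mul]
    norm_num
    have hnb : ‖b‖ = √(1 + κ ^ 2 * t ^ 2) / (2 * t) := by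
      have h2t : 0 ≤ 2 * t := by positivity
      rw [Complex.norm_def, Complex.normSq_apply, hbre, hbim]
      rw [show √(1 + κ ^ 2 * t ^ 2) / (2 * t) = √((1 + κ ^ 2 * t ^ 2) / (2 * t) ^ 2) by
        rw [Real.sqrt_div hD.le, Real.sqrt_sq h2t]]
      congr 1
      field_simp
    rw [hnb, abs_of_pos Real.pi_pos]
    field_simp
  · have h := integral_cexp_quadratic hbneg (n * a / t - I * (2 * Real.pi * ξ : ℝ))
      (-Real.pi * n ^ 2 / (2 * t))
    have e : (-Real.pi * n ^ 2 / (2 * t) : ℂ) -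
        (n * a / t - I * (2 * Real.pi * ξ : ℝ)) ^ 2 / (4 * b) =
        t * (1 + I * κ * t) / (2 * (1 + κ ^ 2 * t ^ 2)) *
          (n * a / t - I * (2 * Real.pi * ξ : ℝ)) ^ 2 - Real.pi * n ^ 2 / (2 * t) := by
      rw [← hbinv]
      ring
    rw [← e, ← h]
    congr 1
    ext x
    rw [ofReal_exp, ← Complex.exp_add, ← Complex.exp_add]
    congr 1
    have haC : (a : ℂ) ^ 2 = Real.pi * (1 - t ^ 2) := by exact_mod_cast ha
    rw [hb]
    push_cast
    field_simp
    linear_combination (-(n : ℂ) ^ 2) * haC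

theorem density_exponent {P a t κ η m₁ m₂ : ℝ} (hP : P ≠ 0) (ht : t ≠ 0)
    (hK : 1 + κ ^ 2 ≠ 0) (ha : a ^ 2 = P * (1 - t ^ 2)) :
    -(P / 4) * t * (m₁ ^ 2 + m₂ ^ 2) -
        1 / (1 + κ ^ 2) * (η - a / 2 * (m₁ * κ + m₂)) ^ 2 / t =
      m₁ ^ 2 * a ^ 2 / (4 * t * (1 + κ ^ 2 * t ^ 2))
        + t / (1 + κ ^ 2 * t ^ 2) * (κ * m₁ * a * η - η ^ 2) - P * m₁ ^ 2 / (4 * t) +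
      -(P / (t * (1 + κ ^ 2) / (1 + κ ^ 2 * t ^ 2))) *
        (m₂ / 2 - a * (η - κ * m₁ * a / 2) / (P * (1 + κ ^ 2 * t ^ 2))) ^ 2 := by
  rw [← sub_eq_zero]
  -- The difference of the two sides is an explicit multiple of a² - P(1 - t²), which vanishes by
  -- `ha`.
  trans (-m₂ ^ 2 / (4 * t * (1 + κ ^ 2)) + (η - κ * m₁ * a / 2) ^ 2 /
    (t * (1 + κ ^ 2) * P * (1 + κ ^ 2 * t ^ 2)) - m₁ ^ 2 / (4 * t)) *
      (a ^ 2 - P * (1 - t ^ 2))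
  · field_simp
    ring
  · rw [ha]
    ring

/-- Supplies the data for `tsum_pauli_resummation` at a fixed point ξ. The factor |`quadratureScale
θ`| is the Jacobian between the density in ξ and the density in q_θ. -/
theorem exists_density_parameters {ε : ℝ} (hε : 0 < ε) (θ ξ : ℝ) :
    ∃ (T : ℝ) (A : ℤ → ℂ) (z : ℤ → ℝ), 0 < T ∧
      (∀ n n' : ℤ, waveNorm ε ^ 2 * (rotatedPeak ε θ n ξ *
        (starRingEnd ℂ) (rotatedPeak ε θ n' ξ)) =
        A (n + n') * cexp (-Real.pi * T * (((n' : ℂ) - n) / 2) ^ 2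
          + 2 * Real.pi * I * z (n + n') * (((n' : ℂ) - n) / 2))) ∧
      ∀ m₁ m₂ : ℤ, ((weight ε (m₁, m₂) * (|quadratureScale θ| *
          gaussDensity ε (quadratureScale θ * ξ - projMean ε θ (m₁, m₂))) : ℝ) : ℂ) =
        A m₁ * (1 / (√T : ℂ) * cexp (-(Real.pi / T) * ((m₂ : ℂ) / 2 - z m₁) ^ 2)) := by
  have ht := tanh_pos hε
  have hc := sech_sq ε
  have hπ := Real.pi_pos
  have hs2 : √(Real.tanh ε) ^ 2 = Real.tanh ε := Real.sq_sqrt ht.le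
  have hs0 : 0 < √(Real.tanh ε) := Real.sqrt_pos.2 ht
  have ha : (1 / Real.cosh ε * √Real.pi) ^ 2 = Real.pi * (1 - Real.tanh ε ^ 2) := by
    rw [mul_pow, hc, Real.sq_sqrt Real.pi_pos.le, mul_comm]
  by_cases hθ : Real.sin θ = 0
  · refine ⟨1 / Real.tanh ε, fun m₁ => ((waveNorm ε ^ 2 * Real.exp (-(ξ - m₁ / 2 *
      (1 / Real.cosh ε * √Real.pi)) ^ 2 / Real.tanh ε - Real.pi * Real.tanh ε * m₁ ^ 2 / 4) : ℝ)
        : ℂ), fun _ => 0, by positivity, fun n n' => ?_, fun m₁ m₂ => ?_⟩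
    · simp only [rotatedPeak, if_pos hθ, Complex.conj_ofReal, peak]
      rw [← ofReal_mul, ← Real.exp_add]
      generalize 1 / Real.cosh ε * √Real.pi = a at *
      generalize Real.tanh ε = t at *
      have htC : (t : ℂ) ≠ 0 := ofReal_ne_zero.2 ht.ne'
      have haC : (a : ℂ) ^ 2 = Real.pi * (1 - t ^ 2) := by exact_mod_cast ha
      rw [ofReal_mul, ofReal_pow, mul_assoc ((waveNorm ε : ℂ) ^ 2), ofReal_exp, ofReal_exp,
        ← Complex.exp_add]
      congr 2
      push_cast
      field_simp
      linear_combination (-4 * ((n' : ℂ) - n) ^ 2) * haC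
    · have hcos : Real.cos θ ^ 2 = 1 := by
        have := Real.sin_sq_add_cos_sq θ
        rw [hθ] at this
        linarith
      have habs : |Real.cos θ| = 1 := by
        rw [← Real.sqrt_sq_eq_abs, hcos, Real.sqrt_one]
      have e : -(Real.pi / 4) * Real.tanh ε * ((m₁ : ℝ) ^ 2 + (m₂ : ℝ) ^ 2) +
          -(Real.cos θ * ξ - 1 / Real.cosh ε * (√Real.pi / 2) *
            (m₁ * Real.cos θ + m₂ * Real.sin θ)) ^ 2 / Real.tanh ε =
          -(ξ - m₁ / 2 * (1 / Real.cosh ε * √Real.pi)) ^ 2 / Real.tanh ε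
            - Real.pi * Real.tanh ε * m₁ ^ 2 / 4 +
          -(Real.pi / (1 / Real.tanh ε)) * ((m₂ : ℝ) / 2 - 0) ^ 2 := by
        rw [hθ]
        have hch := (Real.cosh_pos ε).ne'
        generalize 1 / Real.cosh ε = c at *
        field_simp
        linear_combination (-4 * (2 * ξ - c * √Real.pi * m₁) ^ 2) * hcos
      have hreal : weight ε (m₁, m₂) * (|quadratureScale θ| *
          gaussDensity ε (quadratureScale θ * ξ - projMean ε θ (m₁, m₂))) =
          (waveNorm ε ^ 2 * Real.exp (-(ξ - m₁ / 2 * (1 / Real.cosh ε * √Real.pi)) ^ 2 /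
            Real.tanh ε - Real.pi * Real.tanh ε * m₁ ^ 2 / 4)) *
          (1 / √(1 / Real.tanh ε) *
            Real.exp (-(Real.pi / (1 / Real.tanh ε)) * ((m₂ : ℝ) / 2 - 0) ^ 2)) := by
        rw [quadratureScale, if_pos hθ, habs, one_mul, gaussDensity, weight, projMean,
          mul_left_comm, ← Real.exp_add, e, Real.exp_add, waveNorm_sq hε, Real.sqrt_mul hπ.le,
          Real.sqrt_div zero_le_one, Real.sqrt_one]
        generalize √(Real.tanh ε) = s at *
        rw [← hs2]
        field_simp
      rw [hreal]
      push_cast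
      rfl
  · obtain ⟨w, hw, hpk⟩ := rotatedPeak_eq hε hθ
    set κ := Real.cos θ / Real.sin θ with hκ
    have hD : 0 < 1 + κ ^ 2 * Real.tanh ε ^ 2 := by positivity
    have hK : 0 < 1 + κ ^ 2 := by positivity
    have hsin : Real.sin θ ^ 2 = 1 / (1 + κ ^ 2) := by
      rw [hκ]
      field_simp
      rw [Real.sin_sq_add_cos_sq]
    -- This T is tanh ε / (sin²θ + tanh²ε cos²θ), an expression that equals the value 1 / tanh ε of
    -- the first case when sin θ = 0. It is read off from the coefficient of (n' - n)² in the
    -- product of two rotated peaks.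
    refine ⟨Real.tanh ε * (1 + κ ^ 2) / (1 + κ ^ 2 * Real.tanh ε ^ 2),
      fun m₁ => ((waveNorm ε ^ 2 * (2 * Real.pi * Real.tanh ε / √(1 + κ ^ 2 * Real.tanh ε ^ 2)) *
        Real.exp (m₁ ^ 2 * (1 / Real.cosh ε * √Real.pi) ^ 2 /
          (4 * Real.tanh ε * (1 + κ ^ 2 * Real.tanh ε ^ 2))
        + Real.tanh ε / (1 + κ ^ 2 * Real.tanh ε ^ 2) *
          (κ * m₁ * (1 / Real.cosh ε * √Real.pi) * (2 * Real.pi * ξ) - (2 * Real.pi * ξ) ^ 2)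
        - Real.pi * m₁ ^ 2 / (4 * Real.tanh ε)) : ℝ) : ℂ),
      fun m₁ => (1 / Real.cosh ε * √Real.pi) *
        (2 * Real.pi * ξ - κ * m₁ * (1 / Real.cosh ε * √Real.pi) / 2) /
          (Real.pi * (1 + κ ^ 2 * Real.tanh ε ^ 2)), by positivity, fun n n' => ?_, fun m₁ m₂ => ?_⟩
    · beta_reduce
      rw [hpk, hpk, map_mul, ← Complex.exp_conj, mul_mul_mul_comm, Complex.mul_conj',
        ← Complex.exp_add, ofReal_mul _ (Real.exp _), ofReal_exp, mul_assoc (ofReal _) (cexp _),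
        ← Complex.exp_add, ← hw, ofReal_mul (waveNorm ε ^ 2), ofReal_pow, ofReal_pow, ← mul_assoc]
      congr 2
      simp only [map_sub, map_mul, map_div₀, map_add, map_pow, map_one, Complex.conj_ofReal,
        Complex.conj_I, map_ofNat, map_intCast]
      generalize 1 / Real.cosh ε * √Real.pi = a at *
      generalize Real.tanh ε = t at *
      have htC : (t : ℂ) ≠ 0 := ofReal_ne_zero.2 ht.ne'
      have hDC : (1 + κ ^ 2 * t ^ 2 : ℂ) ≠ 0 := by exact_mod_cast hD.ne'
      have hπC : (Real.pi : ℂ) ≠ 0 := ofReal_ne_zero.2 hπ.ne'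
      have haC : (a : ℂ) ^ 2 = Real.pi * (1 - t ^ 2) := by exact_mod_cast ha
      have hDC' : (1 + t ^ 2 * κ ^ 2 : ℂ) ≠ 0 := by rwa [mul_comm]
      generalize Real.pi = P at *
      generalize hη : 2 * P * ξ = η
      rw [← sub_eq_zero]
      trans (((n' : ℂ) - n) ^ 2 / (4 * t * (1 + κ ^ 2 * t ^ 2))) * (a ^ 2 - P * (1 - t ^ 2))
      · push_cast
        field_simp
        ring_nf
        simp only [I_sq]
        ring
      · rw [haC]
        ring
    · have e : -(Real.pi / 4) * Real.tanh ε * ((m₁ : ℝ) ^ 2 + (m₂ : ℝ) ^ 2) +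
          -(2 * Real.pi * Real.sin θ * ξ - 1 / Real.cosh ε * (√Real.pi / 2) *
            (m₁ * Real.cos θ + m₂ * Real.sin θ)) ^ 2 / Real.tanh ε = _ :=
        Eq.trans (by
          rw [← hsin, hκ]
          field_simp
          ring) (density_exponent (P := Real.pi) (a := 1 / Real.cosh ε * √Real.pi)
            (t := Real.tanh ε) (κ := κ) (η := 2 * Real.pi * ξ) (m₁ := m₁) (m₂ := m₂)
            hπ.ne' ht.ne' hK.ne' ha)
      have hT : √(Real.tanh ε * (1 + κ ^ 2) / (1 + κ ^ 2 * Real.tanh ε ^ 2)) =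
          √(Real.tanh ε) / (|Real.sin θ| * √(1 + κ ^ 2 * Real.tanh ε ^ 2)) := by
        rw [← Real.sqrt_sq_eq_abs, ← Real.sqrt_mul (sq_nonneg _), ← Real.sqrt_div ht.le, hsin]
        congr 1
        field_simp
      have hsD := Real.sqrt_pos.2 hD
      have hsa := abs_pos.2 hθ
      have hpre : 2 * Real.pi * |Real.sin θ| * (1 / √(Real.pi * Real.tanh ε)) =
          waveNorm ε ^ 2 * (2 * Real.pi * Real.tanh ε / √(1 + κ ^ 2 * Real.tanh ε ^ 2)) *
            (1 / √(Real.tanh ε * (1 + κ ^ 2) / (1 + κ ^ 2 * Real.tanh ε ^ 2))) := by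
        rw [hT, waveNorm_sq hε, Real.sqrt_mul hπ.le]
        field_simp
      have hreal : weight ε (m₁, m₂) * (|quadratureScale θ| *
          gaussDensity ε (quadratureScale θ * ξ - projMean ε θ (m₁, m₂))) =
          2 * Real.pi * |Real.sin θ| * (1 / √(Real.pi * Real.tanh ε)) *
            Real.exp (-(Real.pi / 4) * Real.tanh ε * ((m₁ : ℝ) ^ 2 + (m₂ : ℝ) ^ 2) +
          -(2 * Real.pi * Real.sin θ * ξ - 1 / Real.cosh ε * (√Real.pi / 2) *
            (m₁ * Real.cos θ + m₂ * Real.sin θ)) ^ 2 / Real.tanh ε) := by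
        rw [quadratureScale, if_neg hθ, gaussDensity, weight, projMean, Real.exp_add,
          abs_mul, abs_of_pos (by positivity : 0 < 2 * Real.pi)]
        ring
      rw [hreal, hpre, e, Real.exp_add]
      push_cast
      ring


/-! ### The quadrature density as a signed Gaussian mixture. -/

theorem gaussDensity_nonneg (ε x : ℝ) : 0 ≤ gaussDensity ε x := by
  unfold gaussDensity
  positivity

theorem gaussDensity_le {ε : ℝ} (hε : 0 < ε) (x : ℝ) :
    gaussDensity ε x ≤ 1 / √(Real.pi * Real.tanh ε) := by
  have ht := tanh_pos hε
  refine mul_le_of_le_one_right (by positivity) (Real.exp_le_one_iff.2 ?_)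
  rw [neg_div]
  exact neg_nonpos.2 (by positivity)

theorem integral_gaussDensity_sub {ε : ℝ} (hε : 0 < ε) (μ : ℝ) :
    Integrable (fun x => gaussDensity ε (x - μ)) ∧ ∫ x, gaussDensity ε (x - μ) = 1 := by
  have ht := tanh_pos hε
  have e : gaussDensity ε = fun x => 1 / √(Real.pi * Real.tanh ε) *
      Real.exp (-(1 / Real.tanh ε) * x ^ 2) := by
    ext x
    rw [gaussDensity]
    congr 2
    ring
  have hi : Integrable (gaussDensity ε) := by
    rw [e]
    exact (integrable_exp_neg_mul_sq (by positivity)).const_mul _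
  refine ⟨hi.comp_sub_right μ, ?_⟩
  rw [integral_sub_right_eq_self (gaussDensity ε), e, integral_const_mul, integral_gaussian,
    one_div, div_div_eq_mul_div, div_one]
  exact inv_mul_cancel₀ (by positivity)

/-- The probability density of the measured quadrature in the operator `σ_k^ε`. -/
def pauliDensity (ε θ : ℝ) (k : Fin 4) (x : ℝ) : ℝ :=
  ySign k * ∑' m : coset k, weight ε m * sgn k m * gaussDensity ε (x - projMean ε θ m)

theorem summable_weight_mul_gaussDensity {ε : ℝ} (hε : 0 < ε) (θ : ℝ) (k : Fin 4) (x : ℝ) :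
    Summable fun m : coset k => |weight ε m * sgn k m * gaussDensity ε (x - projMean ε θ m)| :=
  summable_weight_mul hε k (g := fun m => gaussDensity ε (x - projMean ε θ m)) fun _ =>
    (abs_of_nonneg (gaussDensity_nonneg ε _)).trans_le (gaussDensity_le hε _)

theorem sum_pauli_rotatedWave {ε : ℝ} (hε : 0 < ε) (θ : ℝ) (k : Fin 4) (ξ : ℝ) :
    ∑ μ, ∑ ν, pauli k μ ν *
        (rotatedWave ε θ μ ξ * (starRingEnd ℂ) (rotatedWave ε θ ν ξ)) =
      ((|quadratureScale θ| * pauliDensity ε θ k (quadratureScale θ * ξ) : ℝ) : ℂ) := by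
  obtain ⟨T, A, z, hT, hA, hG⟩ := exists_density_parameters hε θ ξ
  have hs := summable_norm_rotatedPeak hε θ
  have h1 (μ : Fin 2) : HasSum
      (fun s : ℤ => (waveNorm ε : ℂ) * rotatedPeak ε θ (2 * s + (μ : ℕ)) ξ)
      (rotatedWave ε θ μ ξ) := (hs μ ξ).of_norm.hasSum
  have h2 (μ : Fin 2) := Complex.hasSum_conj'.2 (h1 μ)
  have h2' (ν : Fin 2) : Summable fun s : ℤ => ‖(starRingEnd ℂ)
      ((waveNorm ε : ℂ) * rotatedPeak ε θ (2 * s + (ν : ℕ)) ξ)‖ := by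
    simpa only [RCLike.norm_conj] using hs ν ξ
  have h := hasSum_pauli_mul (k := k) h1 (hs · ξ) h2 h2'
  let F : ℤ → ℤ → ℂ := fun n n' => (waveNorm ε : ℂ) ^ 2 * (rotatedPeak ε θ n ξ *
    (starRingEnd ℂ) (rotatedPeak ε θ n' ξ))
  have h3 := h.congr_fun (g := fun j => pauli k j.1.1 j.2.1 *
      F (2 * j.1.2 + (j.1.1 : ℕ)) (2 * j.2.2 + (j.2.1 : ℕ))) fun j => by
    simp only [F]
    rw [map_mul, Complex.conj_ofReal]
    ring
  let G : ℤ × ℤ → ℝ := fun m => weight ε m * (|quadratureScale θ| *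
    gaussDensity ε (quadratureScale θ * ξ - projMean ε θ m))
  have hG' : Summable fun m : coset k => sgn k m * G m := by
    refine ((summable_weight_mul_gaussDensity hε θ k (quadratureScale θ * ξ)).of_abs.mul_left
      |quadratureScale θ|).congr fun m => ?_
    simp only [G]
    ring
  have h4 := tsum_pauli_resummation k hT (F := F) (A := A) (z := z) (G := G) h3.summable hA hG hG'
  have h5 : ∑' m : coset k, sgn k m * G m = |quadratureScale θ| *
      ∑' m : coset k, weight ε m * sgn k m *
        gaussDensity ε (quadratureScale θ * ξ - projMean ε θ m) := by
    rw [← tsum_mul_left]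
    refine tsum_congr fun m => ?_
    simp only [G]
    ring
  rw [← h3.tsum_eq, h4, h5, pauliDensity, mul_left_comm]

/-! ### The binning function -/

theorem measurableSet_bin (o : Fin 2) : MeasurableSet (bin o) :=
  MeasurableSet.iUnion fun _ => measurableSet_Ico

/-- Since √2 σ = √(tanh ε), the substitution x ↦ (x - μ)/√(tanh ε) turns the Gaussian mass of one
interval into a difference of error functions. -/
theorem binTerm_eq_integral {ε : ℝ} (hε : 0 < ε) (o : Fin 2) (μ : ℝ) (l : ℤ) :
    binTerm ε o μ l = ∫ x in Set.Ico ((2 * l + (o : ℕ)) * √Real.pi - √Real.pi / 2)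
      ((2 * l + (o : ℕ)) * √Real.pi + √Real.pi / 2), gaussDensity ε (x - μ) := by
  have ht := tanh_pos hε
  have hs0 : 0 < √(Real.tanh ε) := Real.sqrt_pos.2 ht
  have hs2 : √(Real.tanh ε) ^ 2 = Real.tanh ε := Real.sq_sqrt ht.le
  have hw : √2 * peakWidth ε = √(Real.tanh ε) := by
    rw [peakWidth, ← Real.sqrt_mul zero_le_two, mul_div_cancel₀ _ two_ne_zero]
  obtain ⟨φ, hφ⟩ : ∃ φ : ℝ → ℝ, φ = fun t => Real.exp (-t ^ 2) := ⟨_, rfl⟩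
  have hc : Continuous φ := by
    rw [hφ]
    fun_prop
  have herf (x : ℝ) : erf x = 2 / √Real.pi * ∫ t in (0 : ℝ)..x, φ t := by rw [hφ, erf]
  rw [integral_Ico_eq_integral_Ioc, ← intervalIntegral.integral_of_le
    (by linarith [Real.sqrt_nonneg Real.pi])]
  have e (x : ℝ) : gaussDensity ε (x - μ) = 1 / √(Real.pi * Real.tanh ε) *
      φ (x / √(Real.tanh ε) - μ / √(Real.tanh ε)) := by
    simp only [gaussDensity, hφ]
    rw [← sub_div, div_pow, hs2, neg_div]
  simp only [e]
  rw [intervalIntegral.integral_const_mul, intervalIntegral.integral_comp_div_sub _ hs0.ne',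
    binTerm, herf, herf, hw, ← mul_sub, intervalIntegral.integral_interval_sub_left
      (hc.intervalIntegrable _ _) (hc.intervalIntegrable _ _), smul_eq_mul,
    Real.sqrt_mul Real.pi_pos.le, ← sub_div, ← sub_div]
  rw [show (2 * (l : ℝ) + (o : ℕ) - 1 / 2) * √Real.pi =
      (2 * l + (o : ℕ)) * √Real.pi - √Real.pi / 2 by ring,
    show (2 * (l : ℝ) + (o : ℕ) + 1 / 2) * √Real.pi =
      (2 * l + (o : ℕ)) * √Real.pi + √Real.pi / 2 by ring]
  have := Real.sqrt_pos.2 Real.pi_pos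
  field_simp

theorem pairwise_disjoint_bin (o : Fin 2) : Pairwise (Function.onFun Disjoint fun s : ℤ =>
    Set.Ico ((2 * s + (o : ℕ)) * √Real.pi - √Real.pi / 2)
      ((2 * s + (o : ℕ)) * √Real.pi + √Real.pi / 2)) := by
  have hw := Real.sqrt_pos.2 Real.pi_pos
  have key {s r : ℤ} {x : ℝ} (h1 : x < (2 * s + (o : ℕ)) * √Real.pi + √Real.pi / 2)
      (h2 : (2 * r + (o : ℕ)) * √Real.pi - √Real.pi / 2 ≤ x) : r ≤ s := by
    by_contra! h
    have h3 : (s : ℝ) + 1 ≤ r := by exact_mod_cast h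
    nlinarith [mul_le_mul_of_nonneg_right h3 hw.le]
  intro s r hsr
  refine Set.disjoint_left.2 fun x hx hx' => hsr ?_
  exact le_antisymm (key hx'.2 hx.1) (key hx.2 hx'.1)

theorem hasSum_binTerm {ε : ℝ} (hε : 0 < ε) (o : Fin 2) (μ : ℝ) :
    HasSum (binTerm ε o μ) (∫ x in bin o, gaussDensity ε (x - μ)) := by
  have h := hasSum_integral_iUnion (f := fun x => gaussDensity ε (x - μ)) (μ := volume)
    (fun _ : ℤ => measurableSet_Ico) (pairwise_disjoint_bin o)
    (integral_gaussDensity_sub hε μ).1.integrableOn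
  simp only [← binTerm_eq_integral hε] at h
  exact h

theorem binTerm_nonneg {ε : ℝ} (hε : 0 < ε) (o : Fin 2) (μ : ℝ) (l : ℤ) : 0 ≤ binTerm ε o μ l := by
  rw [binTerm_eq_integral hε]
  exact integral_nonneg fun _ => gaussDensity_nonneg ε _

theorem binning_eq_integral {ε : ℝ} (hε : 0 < ε) (o : Fin 2) (μ : ℝ) :
    binning ε o μ = ∫ x in bin o, gaussDensity ε (x - μ) :=
  (hasSum_binTerm hε o μ).tsum_eq

theorem binning_nonneg {ε : ℝ} (hε : 0 < ε) (o : Fin 2) (μ : ℝ) : 0 ≤ binning ε o μ :=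
  tsum_nonneg (binTerm_nonneg hε o μ)

theorem abs_binning_le_one {ε : ℝ} (hε : 0 < ε) (o : Fin 2) (μ : ℝ) : |binning ε o μ| ≤ 1 := by
  have h := integral_gaussDensity_sub hε μ
  rw [abs_of_nonneg (binning_nonneg hε o μ), binning_eq_integral hε, ← h.2]
  exact setIntegral_le_integral h.1 (Filter.Eventually.of_forall fun _ => gaussDensity_nonneg ε _)

theorem summable_weight_mul_binning {ε : ℝ} (hε : 0 < ε) (k : Fin 4) (θ : ℝ) (o : Fin 2) :
    Summable fun m : coset k => |weight ε m * sgn k m * binning ε o (projMean ε θ m)| :=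
  summable_weight_mul hε k (g := fun m => binning ε o (projMean ε θ m)) fun m =>
    abs_binning_le_one hε o (projMean ε θ m)

/-- The bin terms are nonnegative, so the inner sum of absolute values is the absolute value of the
m-th term of the series with `binning`, already known to be summable. -/
theorem summable_weight_mul_binTerm {ε : ℝ} (hε : 0 < ε) (k : Fin 4) (θ : ℝ) (o : Fin 2) :
    Summable fun x : coset k × ℤ =>
      |weight ε x.1 * sgn k x.1 * binTerm ε o (projMean ε θ x.1) x.2| := by
  refine (summable_prod_of_nonneg fun _ => abs_nonneg _).2 ⟨fun m => ?_, ?_⟩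
  · change Summable fun l : ℤ => |weight ε m * sgn k m * binTerm ε o (projMean ε θ m) l|
    exact ((hasSum_binTerm hε o (projMean ε θ m)).summable.mul_left (weight ε m * sgn k m)).abs
  · refine (summable_weight_mul_binning hε k θ o).congr fun m => ?_
    simp only [abs_mul _ (binTerm _ _ _ _), abs_of_nonneg (binTerm_nonneg hε o _ _), tsum_mul_left]
    rw [abs_mul _ (binning _ _ _), abs_of_nonneg (binning_nonneg hε o _), binning]

theorem setIntegral_pauliDensity {ε : ℝ} (hε : 0 < ε) (θ : ℝ) (k : Fin 4) (o : Fin 2) :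
    ∫ x in bin o, pauliDensity ε θ k x =
      ySign k * ∑' m : coset k, weight ε m * sgn k m * binning ε o (projMean ε θ m) := by
  have hi (m : coset k) : Integrable
      (fun x => weight ε m * sgn k m * gaussDensity ε (x - projMean ε θ m))
      (volume.restrict (bin o)) :=
    ((integral_gaussDensity_sub hε _).1.const_mul _).restrict
  have h := hasSum_integral_of_summable_integral_norm hi (by
    refine (summable_weight_mul_binning hε k θ o).congr fun m => ?_
    simp only [norm_mul _ (gaussDensity _ _), Real.norm_of_nonneg (gaussDensity_nonneg ε _)]
    rw [integral_const_mul, abs_mul _ (binning _ _ _), abs_of_nonneg (binning_nonneg hε o _),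
      binning_eq_integral hε, Real.norm_eq_abs])
  simp only [pauliDensity]
  rw [integral_const_mul, ← h.tsum_eq]
  congr 1
  refine tsum_congr fun m => ?_
  rw [integral_const_mul, binning_eq_integral hε]

/-! ### The overlaps -/

theorem inner_homodyne_gkpKet {ε : ℝ} (hε : 0 < ε) (θ : ℝ) (o : Fin 2) (μ ν : Fin 2) :
    Integrable (fun ξ => binIndicator θ o ξ *
        (rotatedWave ε θ μ ξ * (starRingEnd ℂ) (rotatedWave ε θ ν ξ))) ∧
      inner ℂ (gkpKet hε ν) (homodyne θ o (gkpKet hε μ)) = ∫ ξ, binIndicator θ o ξ *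
        (rotatedWave ε θ μ ξ * (starRingEnd ℂ) (rotatedWave ε θ ν ξ)) := by
  set f := quadratureRep θ (gkpKet hε ν) with hf
  set g := mulOp (binIndicator θ o) (measurable_binIndicator θ o) (norm_binIndicator_le θ o)
    (quadratureRep θ (gkpKet hε μ)) with hg
  have hae : (fun ξ => inner ℂ (f ξ) (g ξ)) =ᵐ[volume] fun ξ => binIndicator θ o ξ *
      (rotatedWave ε θ μ ξ * (starRingEnd ℂ) (rotatedWave ε θ ν ξ)) := by
    filter_upwards [quadratureRep_gkpKet hε θ μ, quadratureRep_gkpKet hε θ ν,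
      mulOp_coeFn (binIndicator θ o) (measurable_binIndicator θ o) (norm_binIndicator_le θ o)
        (quadratureRep θ (gkpKet hε μ))] with ξ h1 h2 h3
    rw [hg, h3, h1, hf, h2, RCLike.inner_apply, mul_assoc]
  refine ⟨(L2.integrable_inner f g).congr hae, ?_⟩
  rw [homodyne, ContinuousLinearMap.comp_apply, ContinuousLinearMap.adjoint_inner_right,
    ContinuousLinearMap.comp_apply, L2.inner_def]
  exact integral_congr_ae hae

theorem hasTrace_homodyne_comp_gkpPauli {ε : ℝ} (hε : 0 < ε) (k : Fin 4) (θ : ℝ) (o : Fin 2) :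
    HasTrace (homodyne θ o ∘L gkpPauli hε k) ((ySign k * ∑' m : coset k,
      weight ε m * sgn k m * binning ε o (projMean ε θ m) : ℝ) : ℂ) := by
  have h := hasTrace_comp_gkpPauli hε k (homodyne θ o)
  have hi (μ ν : Fin 2) := (inner_homodyne_gkpKet hε θ o μ ν).1.const_mul (pauli k μ ν)
  have hc : ∀ ξ, ∑ μ, ∑ ν, pauli k μ ν * (binIndicator θ o ξ *
      (rotatedWave ε θ μ ξ * (starRingEnd ℂ) (rotatedWave ε θ ν ξ))) =
      ((|quadratureScale θ| * (bin o).indicator (pauliDensity ε θ k) (quadratureScale θ * ξ) : ℝ)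
        : ℂ) := by
    intro ξ
    trans binIndicator θ o ξ * ∑ μ, ∑ ν, pauli k μ ν *
        (rotatedWave ε θ μ ξ * (starRingEnd ℂ) (rotatedWave ε θ ν ξ))
    · simp only [Finset.mul_sum]
      exact Finset.sum_congr rfl fun μ _ => Finset.sum_congr rfl fun ν _ => mul_left_comm _ _ _
    rw [sum_pauli_rotatedWave hε]
    by_cases hb : quadratureScale θ * ξ ∈ bin o
    · have : ξ ∈ quadratureValue θ ⁻¹' bin o := by
        rwa [Set.mem_preimage, quadratureValue_eq]
      rw [binIndicator, Set.indicator_of_mem this, Set.indicator_of_mem hb, Pi.one_apply, one_mul]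
    · have : ξ ∉ quadratureValue θ ⁻¹' bin o := by
        rwa [Set.mem_preimage, quadratureValue_eq]
      rw [binIndicator, Set.indicator_of_notMem this, Set.indicator_of_notMem hb]
      simp
  have e : ∑ μ, ∑ ν, pauli k μ ν * inner ℂ (gkpKet hε ν) (homodyne θ o (gkpKet hε μ)) =
      ((ySign k * ∑' m : coset k,
        weight ε m * sgn k m * binning ε o (projMean ε θ m) : ℝ) : ℂ) := by
    simp only [(inner_homodyne_gkpKet hε θ o _ _).2, ← integral_const_mul]
    simp only [← integral_finsetSum _ fun ν _ => hi _ ν]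
    rw [← integral_finsetSum _ fun μ _ => integrable_finsetSum _ fun ν _ => hi μ ν]
    simp only [hc]
    -- Changing variables from ξ to q_θ = `quadratureScale θ` · ξ cancels the Jacobian in the
    -- density, which leaves no explicit dependence on the scale.
    rw [integral_complex_ofReal, integral_const_mul, Measure.integral_comp_mul_left, smul_eq_mul,
      ← mul_assoc, abs_inv, mul_inv_cancel₀ (abs_ne_zero.2 (quadratureScale_ne_zero θ)), one_mul,
      integral_indicator (measurableSet_bin o), setIntegral_pauliDensity hε]
  rwa [e] at h

end GKP

end

theorem mainTheorem2 {ε : ℝ} (hε : 0 < ε) (k : Fin 4) :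
    -- the Wigner function of the GKP Pauli operator is the Gaussian mixture
    ((∀ q p : ℝ, Summable fun m : GKP.coset k =>
        |GKP.weight ε m * GKP.sgn k m * GKP.latticeGaussian ε m q p|) ∧
      GKP.HasWignerFunction (GKP.gkpPauli hε k) (fun q p =>
        ((GKP.ySign k * ∑' m : GKP.coset k,
          GKP.weight ε m * GKP.sgn k m * GKP.latticeGaussian ε m q p : ℝ) : ℂ))) ∧
    -- the single-mode overlaps
    ∀ (θ : ℝ) (o : Fin 2),
      (∀ μ : ℝ, Summable fun l : ℤ => |GKP.binTerm ε o μ l|) ∧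
      (Summable fun m : GKP.coset k =>
        |GKP.weight ε m * GKP.sgn k m * GKP.binning ε o (GKP.projMean ε θ m)|) ∧
      (Summable fun x : GKP.coset k × ℤ =>
        |GKP.weight ε x.1 * GKP.sgn k x.1 * GKP.binTerm ε o (GKP.projMean ε θ x.1) x.2|) ∧
      GKP.HasTrace (GKP.homodyne θ o ∘L GKP.gkpPauli hε k)
        ((GKP.ySign k * ∑' m : GKP.coset k,
          GKP.weight ε m * GKP.sgn k m * GKP.binning ε o (GKP.projMean ε θ m) : ℝ) : ℂ) :=
  ⟨⟨fun q p => GKP.summable_weight_mul hε k (g := fun m => GKP.latticeGaussian ε m q p)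
      (GKP.abs_latticeGaussian_le ε · q p),
    GKP.hasWignerFunction_gkpPauli hε k⟩, fun θ o =>
    ⟨fun μ => (GKP.hasSum_binTerm hε o μ).summable.abs,
      GKP.summable_weight_mul_binning hε k θ o,
      GKP.summable_weight_mul_binTerm hε k θ o, GKP.hasTrace_homodyne_comp_gkpPauli hε k θ o⟩⟩
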